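/- Let $B$ be a unital $C^*$-algebra, let $E = E(B) = B * C(\mathbb T)$ be the unital full free product $C^*$-algebra (amalgamated over $\mathbb C 1$), regard $B \subset E$, and let $u \in E$ be the universal unitary, i.e. the image of the inclusion function $\mathbb T \hookrightarrow \mathbb C$. Notation. For a unital ring $R$ let $Gr(R) = GL(2;R)/\!\sim$, where two matrices are equivalent iff their second columns satisfy $b' = bt$, $d' = dt$ for some invertible $t \in R$; put $Gr_n(B) = Gr(\mathfrak M_n(B))$ and $Gr_1(E) = Gr(E)$. For $\pi \in Gr_1(E)$ with second column $(b,d)$ and $\sigma \in Gr_n(B)$ with second column $(\beta,\delta)$, we say $\sigma \in \widetilde\rho_n(\pi;B)$ iff $\begin{pmatrix} I_n\otimes b & \beta\\ I_n \otimes d & \delta\end{pmatrix}$ is invertible over $\mathfrak M_n(E)$, and then $\widetilde{\mathcal R}_n(\pi;B)(\sigma) = \beta\zeta \in \mathfrak M_n(E)$, where $\zeta$ is the $(2,2)$ entry of the inverse of this matrix. $\mathcal{LR}(\pi;B) \subset E$ is the linear span of all matrix coefficients of all $-\widetilde{\mathcal R}_n(\pi;B)(\sigma)$, $n \in \mathbb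 N$, $\sigma \in \widetilde\rho_n(\pi;B)$; it is a (possibly non-unital) subalgebra of $E$. $\mathcal{QR}(\pi;B)$ is the smallest subalgebra of $E$ that contains $B \cup \mathcal{LR}(\pi;B)$ and is closed under inverses in $E$. An element $Y \in E$ is identified with the class of $\begin{pmatrix}0&1\\1&Y\end{pmatrix}$ in $Gr_1(E)$, and $\chi \in Gr_1(E)$ is the class of $\begin{pmatrix}-i&i\\1&1\end{pmatrix}\begin{pmatrix}0&1\\1&u\end{pmatrix}$. Tensor products are algebraic over $\mathbb C$; a derivation $\partial: A \to A\otimes A$ is a linear map with $\partial(xy) = x\,\partial(y) + \partial(x)\,y$ for the bimodule structure $x(a\otimes b)y = xa \otimes by$; and $(X \otimes_{\mathfrak M_n} Y)_{ij} = \sum_k X_{ik}\otimes Y_{kj}$. Then: (1) There is a derivation $\partial^{\mathcal Q}: \mathcal{QR}(u;B) \to \mathcal{QR}(u;B)\otimes\mathcal{QR}(u;B)$ with $\partial^{\mathcal Q}|_B = 0$, $u \in \mathcal{QR}(u;B)$, $\partial^{\mathcal Q}u = 1\otimes 1$ and $$(\mathrm{id}_{\mathfrak M_n}\otimes\partial^{\mathcal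 Q})\widetilde{\mathcal R}_n(u;B)(\sigma) = \widetilde{\mathcal R}_n(u;B)(\sigma)\otimes_{\mathfrak M_n}\widetilde{\mathcal R}_n(u;B)(\sigma)$$ for all $n \in \mathbb N$ and $\sigma \in \widetilde\rho_n(u;B)$. (2) $\partial^{\mathcal Q}$ restricts to a derivation $\partial_{u:B}: \mathcal{LR}(u;B)\to\mathcal{LR}(u;B)\otimes\mathcal{LR}(u;B)$, which satisfies the same identity. (3) There is a linear map $D: \mathcal{LR}(u;B) \to E$ such that for all $n \in \mathbb N$ and $\sigma\in\widetilde\rho_n(u;B)$ one has $\sigma \in \widetilde\rho_n(e^tu;B)$ for all $t \in \mathbb C$ near $0$, the function $t \mapsto \widetilde{\mathcal R}_n(e^tu;B)(\sigma)$ is complex differentiable at $0$, and $$(\mathrm{id}_{\mathfrak M_n}\otimes D)\widetilde{\mathcal R}_n(u;B)(\sigma) = \left.\frac{d}{dt}\widetilde{\mathcal R}_n(e^tu;B)(\sigma)\right|_{t=0}.$$ (4) $\mathcal{LR}(\chi;B)\subset\mathcal{QR}(u;B)$, and $$\partial_{\chi:B}\,\xi = -\frac i2\,(1\otimes(1-u))\,(\partial^{\mathcal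 Q}\xi)\,((1-u)\otimes 1) \qquad (\xi\in\mathcal{LR}(\chi;B))$$ (products in the algebra $\mathcal{QR}(u;B)\otimes\mathcal{QR}(u;B)$) defines a derivation of $\mathcal{LR}(\chi;B)$ into $\mathcal{LR}(\chi;B)\otimes\mathcal{LR}(\chi;B)$ such that $$(\mathrm{id}_{\mathfrak M_n}\otimes\partial_{\chi:B})\widetilde{\mathcal R}_n(\chi;B)(\nu) = \widetilde{\mathcal R}_n(\chi;B)(\nu)\otimes_{\mathfrak M_n}\widetilde{\mathcal R}_n(\chi;B)(\nu)$$ for all $n\in\mathbb N$ and $\nu\in\widetilde\rho_n(\chi;B)$. -/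

import Mathlib

open scoped ENNReal TensorProduct Topology

noncomputable section

universe u v

namespace VoicFree

section FreeProduct

/-- The `ℓ^∞`-product of a family of unital C⋆-algebras is a unital C⋆-algebra. -/
instance lpInftyCStarAlgebra {I : Type*} {A : I → Type*} [∀ i, Nontrivial (A i)]
    [∀ i, CStarAlgebra (A i)] : CStarAlgebra (lp A ∞) where

/-- A representation of the pair `(A₁, A₂)`: two unital ⋆-homomorphisms into a common nonzero
unital C⋆-algebra. -/
structure FreeProdRep (A₁ : Type u) (A₂ : Type v) [CStarAlgebra A₁] [CStarAlgebra A₂] where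
  carrier : Type (max u v)
  [cstar : CStarAlgebra carrier]
  [nontriv : Nontrivial carrier]
  f : A₁ →⋆ₐ[ℂ] carrier
  g : A₂ →⋆ₐ[ℂ] carrier

attribute [instance] FreeProdRep.cstar FreeProdRep.nontriv

/-- The value of a noncommutative polynomial with letters in `A₁` and `A₂` in a representation. -/
def FreeProdRep.eval {A₁ : Type u} {A₂ : Type v} [CStarAlgebra A₁] [CStarAlgebra A₂] (π : FreeProdRep A₁ A₂) :
   FreeAlgebra ℂ (A₁ ⊕ A₂) →ₐ[ℂ] π.carrier :=
  FreeAlgebra.lift ℂ (Sum.elim π.f π.g)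

/-- The set of all C⋆-seminorms on noncommutative polynomials that come from a representation of
the pair. Indexing by these seminorms, and not by the representations, keeps the free product in
the universe of `A₁` and `A₂`. -/
def FreeProdIndex (A₁ : Type u) (A₂ : Type v) [CStarAlgebra A₁] [CStarAlgebra A₂] : Type (max u v) :=
  {p : FreeAlgebra ℂ (A₁ ⊕ A₂) → ℝ // ∃ π : FreeProdRep A₁ A₂, ∀ w, ‖π.eval w‖ = p w}

/-- A representation that induces the given seminorm. -/
def FreeProdIndex.rep {A₁ : Type u} {A₂ : Type v} [CStarAlgebra A₁] [CStarAlgebra A₂]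
    (p : FreeProdIndex A₁ A₂) : FreeProdRep A₁ A₂ := p.2.choose

variable (A₁ : Type u) (A₂ : Type v) [CStarAlgebra A₁] [CStarAlgebra A₂]

/-- The C⋆-product of representations, one for each seminorm. -/
abbrev FreeProdAmbient : Type (max u v) := lp (fun p : FreeProdIndex A₁ A₂ => p.rep.carrier) ∞

theorem FreeProdRep.memℓp_f (a : A₁) : Memℓp (fun p : FreeProdIndex A₁ A₂ => p.rep.f a) ∞ :=
  memℓp_infty ⟨‖a‖, by rintro _ ⟨p, rfl⟩; exact NonUnitalStarAlgHom.norm_apply_le p.rep.f a⟩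

theorem FreeProdRep.memℓp_g (a : A₂) : Memℓp (fun p : FreeProdIndex A₁ A₂ => p.rep.g a) ∞ :=
  memℓp_infty ⟨‖a‖, by rintro _ ⟨p, rfl⟩; exact NonUnitalStarAlgHom.norm_apply_le p.rep.g a⟩

/-- `A₁` acting in all representations at once. -/
def FreeProdAmbient.inl : A₁ →⋆ₐ[ℂ] FreeProdAmbient A₁ A₂ where
  toFun a := ⟨fun p => p.rep.f a, FreeProdRep.memℓp_f A₁ A₂ a⟩
  map_one' := by ext p; exact map_one p.rep.f
  map_mul' a b := by ext p; exact map_mul p.rep.f a b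
  map_zero' := by ext p; exact map_zero p.rep.f
  map_add' a b := by ext p; exact map_add p.rep.f a b
  commutes' c := by ext p; exact AlgHomClass.commutes p.rep.f c
  map_star' a := by ext p; exact map_star p.rep.f a

/-- `A₂` acting in all representations at once. -/
def FreeProdAmbient.inr : A₂ →⋆ₐ[ℂ] FreeProdAmbient A₁ A₂ where
  toFun a := ⟨fun p => p.rep.g a, FreeProdRep.memℓp_g A₁ A₂ a⟩
  map_one' := by ext p; exact map_one p.rep.g
  map_mul' a b := by ext p; exact map_mul p.rep.g a b
  map_zero' := by ext p; exact map_zero p.rep.g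
  map_add' a b := by ext p; exact map_add p.rep.g a b
  commutes' c := by ext p; exact AlgHomClass.commutes p.rep.g c
  map_star' a := by ext p; exact map_star p.rep.g a

/-- The C⋆-subalgebra generated by the images of `A₁` and `A₂`: noncommutative polynomials,
completed for the supremum of all seminorms coming from representations. -/
def freeProdSubalgebra : StarSubalgebra ℂ (FreeProdAmbient A₁ A₂) :=
  (StarAlgebra.adjoin ℂ (Set.range (FreeProdAmbient.inl A₁ A₂) ∪
    Set.range (FreeProdAmbient.inr A₁ A₂))).topologicalClosure

instance : IsClosed (freeProdSubalgebra A₁ A₂ : Set (FreeProdAmbient A₁ A₂)) :=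
  StarSubalgebra.isClosed_topologicalClosure _

/-- The unital full free product `A₁ * A₂` of C⋆-algebras (with amalgamation over `ℂ 1`).
`FreeProd.exists_lift` and `FreeProd.hom_ext` are its universal property. -/
def FreeProd : Type (max u v) := ↥(freeProdSubalgebra A₁ A₂)

instance : CStarAlgebra (FreeProd A₁ A₂) :=
  inferInstanceAs (CStarAlgebra ↥(freeProdSubalgebra A₁ A₂))

/-- The canonical map `A₁ → A₁ * A₂`. -/
def FreeProd.inl : A₁ →⋆ₐ[ℂ] FreeProd A₁ A₂ :=
  (FreeProdAmbient.inl A₁ A₂).codRestrict (freeProdSubalgebra A₁ A₂) fun a =>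
    StarSubalgebra.le_topologicalClosure _ (StarAlgebra.subset_adjoin ℂ _ (.inl ⟨a, rfl⟩))

/-- The canonical map `A₂ → A₁ * A₂`. -/
def FreeProd.inr : A₂ →⋆ₐ[ℂ] FreeProd A₁ A₂ :=
  (FreeProdAmbient.inr A₁ A₂).codRestrict (freeProdSubalgebra A₁ A₂) fun a =>
    StarSubalgebra.le_topologicalClosure _ (StarAlgebra.subset_adjoin ℂ _ (.inr ⟨a, rfl⟩))


variable {A₁ A₂}

theorem FreeProd.hom_ext {A : Type*} [CStarAlgebra A] {φ ψ : FreeProd A₁ A₂ →⋆ₐ[ℂ] A}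
    (hl : ∀ a, φ (FreeProd.inl A₁ A₂ a) = ψ (FreeProd.inl A₁ A₂ a))
    (hr : ∀ b, φ (FreeProd.inr A₁ A₂ b) = ψ (FreeProd.inr A₁ A₂ b)) : φ = ψ := by
  have hcφ : Continuous φ := AddMonoidHomClass.continuous_of_bound φ 1 fun x => by
    simpa using NonUnitalStarAlgHom.norm_apply_le φ x
  have hcψ : Continuous ψ := AddMonoidHomClass.continuous_of_bound ψ 1 fun x => by
    simpa using NonUnitalStarAlgHom.norm_apply_le ψ x
  have hle := StarSubalgebra.le_topologicalClosure (StarAlgebra.adjoin ℂ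
    (Set.range (FreeProdAmbient.inl A₁ A₂) ∪ Set.range (FreeProdAmbient.inr A₁ A₂)))
  refine StarAlgHom.ext_topologicalClosure (A := FreeProdAmbient A₁ A₂) hcφ hcψ ?_
  refine StarAlgHom.ext_adjoin fun x hx => ?_
  rcases hx with ⟨a, ha⟩ | ⟨a, ha⟩
  · have : StarSubalgebra.inclusion hle x = FreeProd.inl A₁ A₂ a := Subtype.ext ha.symm
    exact (congrArg φ this).trans ((hl a).trans (congrArg ψ this).symm)
  · have : StarSubalgebra.inclusion hle x = FreeProd.inr A₁ A₂ a := Subtype.ext ha.symm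
    exact (congrArg φ this).trans ((hr a).trans (congrArg ψ this).symm)

/-- Restriction of a coordinate of the product to the free product. -/
def FreeProd.coord (p : FreeProdIndex A₁ A₂) : FreeProd A₁ A₂ →⋆ₐ[ℂ] p.rep.carrier where
  toFun x := x.1 p
  map_one' := rfl
  map_mul' _ _ := rfl
  map_zero' := rfl
  map_add' _ _ := rfl
  commutes' _ := rfl
  map_star' _ := rfl

theorem FreeProd.exists_lift {A : Type (max u v)} [CStarAlgebra A] (f : A₁ →⋆ₐ[ℂ] A)
    (g : A₂ →⋆ₐ[ℂ] A) : ∃ φ : FreeProd A₁ A₂ →⋆ₐ[ℂ] A,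
      (∀ a, φ (FreeProd.inl A₁ A₂ a) = f a) ∧ ∀ b, φ (FreeProd.inr A₁ A₂ b) = g b := by
  rcases subsingleton_or_nontrivial A with hA | hA
  · exact ⟨⟨⟨⟨⟨⟨fun _ => 0, Subsingleton.elim _ _⟩, fun _ _ => Subsingleton.elim _ _⟩,
      Subsingleton.elim _ _, fun _ _ => Subsingleton.elim _ _⟩, fun _ => Subsingleton.elim _ _⟩,
      fun _ => Subsingleton.elim _ _⟩, fun _ => Subsingleton.elim _ _, fun _ => Subsingleton.elim _ _⟩
  let π : FreeProdRep A₁ A₂ := ⟨A, f, g⟩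
  let p : FreeProdIndex A₁ A₂ := ⟨fun w => ‖π.eval w‖, π, fun _ => rfl⟩
  have hp : ∀ w, ‖p.rep.eval w‖ = ‖π.eval w‖ := p.2.choose_spec
  let k₁ : A₁ →⋆ₐ[ℂ] FreeProd A₁ A₂ × A := (FreeProd.inl A₁ A₂).prod f
  let k₂ : A₂ →⋆ₐ[ℂ] FreeProd A₁ A₂ × A := (FreeProd.inr A₁ A₂).prod g
  let G₀ := StarAlgebra.adjoin ℂ (Set.range k₁ ∪ Set.range k₂)
  have h₀ : ∀ z ∈ G₀, ‖z.2‖ ≤ ‖z.1‖ := by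
    let ev : FreeAlgebra ℂ (A₁ ⊕ A₂) →ₐ[ℂ] FreeProd A₁ A₂ × A :=
      FreeAlgebra.lift ℂ (Sum.elim k₁ k₂)
    have hle : G₀.toSubalgebra ≤ ev.range := by
      rw [StarAlgebra.adjoin_toSubalgebra]
      have key : Set.range k₁ ∪ Set.range k₂ ⊆ (ev.range : Set (FreeProd A₁ A₂ × A)) := by
        rintro _ (⟨a, rfl⟩ | ⟨a, rfl⟩)
        · exact ⟨FreeAlgebra.ι ℂ (Sum.inl a), by simp [ev]⟩
        · exact ⟨FreeAlgebra.ι ℂ (Sum.inr a), by simp [ev]⟩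
      refine Algebra.adjoin_le (Set.union_subset key ?_)
      intro z hz
      rw [Set.mem_star] at hz
      apply key
      rcases hz with ⟨a, ha⟩ | ⟨a, ha⟩
      · exact .inl ⟨star a, by rw [map_star, ha, star_star]⟩
      · exact .inr ⟨star a, by rw [map_star, ha, star_star]⟩
    intro z hz
    obtain ⟨w, rfl⟩ := hle hz
    have e2 : (AlgHom.snd ℂ _ _).comp ev = π.eval := by
      refine FreeAlgebra.hom_ext (funext fun x => ?_)
      rcases x with a | a <;> simp [ev, FreeProdRep.eval, k₁, k₂, π]
    have e1 : ((FreeProd.coord p : FreeProd A₁ A₂ →ₐ[ℂ] _).comp (AlgHom.fst ℂ _ _)).comp ev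
        = p.rep.eval := by
      refine FreeAlgebra.hom_ext (funext fun x => ?_)
      rcases x with a | a <;> simp [ev, FreeProdRep.eval, k₁, k₂] <;> rfl
    calc ‖(ev w).2‖ = ‖π.eval w‖ := congrArg norm (DFunLike.congr_fun e2 w)
      _ = ‖FreeProd.coord p (ev w).1‖ := by
        rw [← hp]; exact congrArg norm (DFunLike.congr_fun e1 w).symm
      _ ≤ ‖(ev w).1‖ := NonUnitalStarAlgHom.norm_apply_le _ _
  have h₁ : ∀ z ∈ G₀.topologicalClosure, ‖z.2‖ ≤ ‖z.1‖ := by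
    have hc : IsClosed {z : FreeProd A₁ A₂ × A | ‖z.2‖ ≤ ‖z.1‖} :=
      isClosed_le (by fun_prop) (by fun_prop)
    exact fun z hz => closure_minimal (s := (G₀ : Set (FreeProd A₁ A₂ × A))) h₀ hc hz
  let G := G₀.topologicalClosure
  have hk₁ : ∀ a, k₁ a ∈ G := fun a =>
    StarSubalgebra.le_topologicalClosure _ (StarAlgebra.subset_adjoin ℂ _ (.inl ⟨a, rfl⟩))
  have hk₂ : ∀ a, k₂ a ∈ G := fun a =>
    StarSubalgebra.le_topologicalClosure _ (StarAlgebra.subset_adjoin ℂ _ (.inr ⟨a, rfl⟩))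
  have hG : IsClosed (G : Set (FreeProd A₁ A₂ × A)) := StarSubalgebra.isClosed_topologicalClosure _
  let q : G →⋆ₐ[ℂ] FreeProd A₁ A₂ := (StarAlgHom.fst ℂ _ _).comp G.subtype
  have hinj : Function.Injective q := by
    rw [injective_iff_map_eq_zero]
    intro z hz
    have h1 : z.1.1 = 0 := hz
    have h2 := h₁ z.1 z.2
    rw [h1, norm_zero, norm_le_zero_iff] at h2
    exact Subtype.ext (Prod.ext h1 h2)
  have hiso : Isometry q := NonUnitalStarAlgHom.isometry q hinj
  have hsurj : Function.Surjective q := by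
    let q' : G →⋆ₐ[ℂ] FreeProdAmbient A₁ A₂ := (freeProdSubalgebra A₁ A₂).subtype.comp q
    have hcl : IsClosed (q'.range : Set (FreeProdAmbient A₁ A₂)) := by
      have : Isometry q' := isometry_subtype_coe.comp hiso
      have h : IsClosed (Set.range q') := this.isClosedEmbedding.isClosed_range
      exact h
    have hle : freeProdSubalgebra A₁ A₂ ≤ q'.range := by
      refine StarSubalgebra.topologicalClosure_minimal (StarAlgebra.adjoin_le ?_) hcl
      rintro _ (⟨a, rfl⟩ | ⟨a, rfl⟩)
      · exact ⟨⟨k₁ a, hk₁ a⟩, rfl⟩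
      · exact ⟨⟨k₂ a, hk₂ a⟩, rfl⟩
    intro x
    obtain ⟨z, hz⟩ := hle x.2
    exact ⟨z, Subtype.ext hz⟩
  let e := StarAlgEquiv.ofBijective q ⟨hinj, hsurj⟩
  refine ⟨((StarAlgHom.snd ℂ _ _).comp G.subtype).comp (e.symm : FreeProd A₁ A₂ →⋆ₐ[ℂ] G), ?_, ?_⟩
  · intro a
    have : e.symm (FreeProd.inl A₁ A₂ a) = ⟨k₁ a, hk₁ a⟩ := (StarAlgEquiv.symm_apply_eq e).2 rfl
    exact congrArg (fun z : G => z.1.2) this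
  · intro a
    have : e.symm (FreeProd.inr A₁ A₂ a) = ⟨k₂ a, hk₂ a⟩ := (StarAlgEquiv.symm_apply_eq e).2 rfl
    exact congrArg (fun z : G => z.1.2) this

end FreeProduct

/-- `GL(2; R)` for a (noncommutative) ring `R`. -/
abbrev GL2 (R : Type*) [Ring R] : Type _ := (Matrix (Fin 2) (Fin 2) R)ˣ

/-- Two elements of `GL(2; R)` are equivalent iff their second columns `(b, d)` differ by right
multiplication by an invertible element of `R`. -/
def grSetoid (R : Type*) [Ring R] : Setoid (GL2 R) where
  r g h := ∃ t : Rˣ, g.1 0 1 * t = h.1 0 1 ∧ g.1 1 1 * t = h.1 1 1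
  iseqv :=
    { refl := fun g => ⟨1, by simp⟩
      symm := by
        rintro g h ⟨t, h1, h2⟩
        exact ⟨t⁻¹, by rw [← h1, Units.mul_inv_cancel_right], by rw [← h2, Units.mul_inv_cancel_right]⟩
      trans := by
        rintro g h k ⟨t, h1, h2⟩ ⟨s, h3, h4⟩
        exact ⟨t * s, by rw [← h3, ← h1, Units.val_mul, mul_assoc],
          by rw [← h4, ← h2, Units.val_mul, mul_assoc]⟩ }

/-- The Grassmannian `GL(2; R) / ∼`. Thus `Gr_n(B)` is `Gr (Matrix (Fin n) (Fin n) B)`, and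
`Gr_1(E)` is `Gr E`. -/
def Gr (R : Type*) [Ring R] : Type _ := Quotient (grSetoid R)

/-- The class of an element of `GL(2; R)`. -/
def Gr.mk {R : Type*} [Ring R] (g : GL2 R) : Gr R := Quotient.mk (grSetoid R) g

/-- The action of `GL(2; R)` on `Gr R` by left multiplication. -/
def Gr.act {R : Type*} [Ring R] (g : GL2 R) : Gr R → Gr R :=
  Quotient.map (sa := grSetoid R) (sb := grSetoid R) (fun h => g * h) (by
    rintro h k ⟨t, h1, h2⟩
    refine ⟨t, ?_, ?_⟩ <;>
      simp [Matrix.mul_apply, Fin.sum_univ_two, ← h1, ← h2, add_mul, mul_assoc])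

/-- The graph of `Y`, that is the class of the matrix with rows `0, 1` and `1, Y`. -/
def Gr.graph {R : Type*} [Ring R] (Y : R) : Gr R :=
  Gr.mk ⟨!![0, 1; 1, Y], !![-Y, 1; 1, 0], by simp [Matrix.one_fin_two], by simp [Matrix.one_fin_two]⟩

section Resolvent
variable {B E : Type*} [Ring B] [Ring E] (ι : B →+* E) {n : Type*} [Fintype n] [DecidableEq n]

/-- For `π` in `Gr_1(E)` with second column `(b, d)` and `σ` in `Gr_n(B)` with second column
`(β, δ)`: the matrix with rows `I_n ⊗ b, β` and `I_n ⊗ d, δ`. Here `ι : B → E` is the inclusion. -/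
def pairMatrix (p : GL2 E) (s : GL2 (Matrix n n B)) : Matrix (Fin 2) (Fin 2) (Matrix n n E) :=
  !![Matrix.scalar n (p.1 0 1), (s.1 0 1).map ι; Matrix.scalar n (p.1 1 1), (s.1 1 1).map ι]

/-- On representatives: `σ` is a complement of `π ⊕ ⋯ ⊕ π`. -/
def transversalRep (p : GL2 E) (s : GL2 (Matrix n n B)) : Prop := IsUnit (pairMatrix ι p s)

/-- On representatives: `β ζ`, where `ζ` is the lower right entry of the inverse of the matrix
above. -/
def resolventRep (p : GL2 E) (s : GL2 (Matrix n n B)) : Matrix n n E :=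
  (s.1 0 1).map ι * Ring.inverse (pairMatrix ι p s) 1 1

theorem pairMatrix_congr {p p' : GL2 E} {s s' : GL2 (Matrix n n B)}
    (hp : grSetoid E p p') (hs : grSetoid (Matrix n n B) s s') :
    ∃ D : (Matrix (Fin 2) (Fin 2) (Matrix n n E))ˣ, ∃ τ : (Matrix n n B)ˣ,
      pairMatrix ι p' s' = pairMatrix ι p s * D ∧ (s'.1 0 1) = (s.1 0 1) * τ ∧
      D⁻¹.1 1 0 = 0 ∧ D⁻¹.1 1 1 = (τ⁻¹.1).map ι := by
  obtain ⟨t, h1, h2⟩ := hp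
  obtain ⟨τ, h3, h4⟩ := hs
  have e : ∀ x : E, ∀ y : E, Matrix.scalar n x * Matrix.scalar n y = Matrix.scalar n (x * y) :=
    fun x y => (map_mul _ x y).symm
  have e' : ∀ x y : Matrix n n B, x.map ι * y.map ι = (x * y).map ι :=
    fun x y => (Matrix.map_mul).symm
  refine ⟨⟨!![Matrix.scalar n t, 0; 0, τ.1.map ι], !![Matrix.scalar n t⁻¹.1, 0; 0, τ⁻¹.1.map ι],
    ?_, ?_⟩, τ, ?_, h3.symm, ?_, ?_⟩
  · rw [Matrix.mul_fin_two, e, e']; simp [Matrix.one_fin_two]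
  · rw [Matrix.mul_fin_two, e, e']; simp [Matrix.one_fin_two]
  · simp only [pairMatrix]
    rw [Matrix.mul_fin_two, e, e', e, e', h1, h2, h3, h4]; simp
  · rfl
  · rfl

theorem transversalRep_congr (p : GL2 E) (s : GL2 (Matrix n n B)) (p' : GL2 E)
    (s' : GL2 (Matrix n n B)) (hp : grSetoid E p p') (hs : grSetoid (Matrix n n B) s s') :
    transversalRep ι p s = transversalRep ι p' s' := by
  obtain ⟨D, τ, h1, -⟩ := pairMatrix_congr ι hp hs
  simp only [transversalRep, h1, Units.isUnit_mul_units]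

theorem resolventRep_congr (p : GL2 E) (s : GL2 (Matrix n n B)) (p' : GL2 E)
    (s' : GL2 (Matrix n n B)) (hp : grSetoid E p p') (hs : grSetoid (Matrix n n B) s s') :
    resolventRep ι p s = resolventRep ι p' s' := by
  obtain ⟨D, τ, h1, h2, h3, h4⟩ := pairMatrix_congr ι hp hs
  have : Ring.inverse (pairMatrix ι p' s') = D⁻¹.1 * Ring.inverse (pairMatrix ι p s) := by
    rw [h1]
    by_cases hu : IsUnit (pairMatrix ι p s)
    · obtain ⟨v, hv⟩ := hu
      rw [← hv, ← Units.val_mul, Ring.inverse_unit, Ring.inverse_unit, mul_inv_rev, Units.val_mul]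
    · rw [Ring.inverse_non_unit _ hu, Ring.inverse_non_unit _ (by simpa using hu), mul_zero]
  rw [resolventRep, resolventRep, this, h2, Matrix.mul_apply (M := D⁻¹.1), Fin.sum_univ_two, h3, h4,
    zero_mul, zero_add, Matrix.map_mul, mul_assoc, ← mul_assoc (τ.1.map ι), ← Matrix.map_mul]
  simp

/-- The `n`-th Grassmannian `B`-resolvent set of `π ∈ Gr_1(E)`. -/
def grResolventSet (n : Type*) [Fintype n] [DecidableEq n] (π : Gr E) : Set (Gr (Matrix n n B)) :=
  {σ | Quotient.liftOn₂ π σ (transversalRep ι) (transversalRep_congr ι)}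

/-- The `n`-th Grassmannian `B`-resolvent of `π ∈ Gr_1(E)` (only meaningful on the resolvent
set). -/
def grResolvent (π : Gr E) (σ : Gr (Matrix n n B)) : Matrix n n E :=
  Quotient.liftOn₂ π σ (resolventRep ι) (resolventRep_congr ι)

/-- The set of all matrix coefficients of the negatives of the Grassmannian resolvents of `π`. -/
def resolventCoeffs (π : Gr E) : Set E :=
  {x | ∃ (n : ℕ) (σ : Gr (Matrix (Fin n) (Fin n) B)) (i j : Fin n),
    σ ∈ grResolventSet ι (Fin n) π ∧ x = (-grResolvent ι π σ) i j}


/-- Block diagonal sum. -/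
def dsum (R : Type*) [Ring R] (m n : ℕ) : Matrix (Fin m) (Fin m) R × Matrix (Fin n) (Fin n) R →+*
    Matrix (Fin (m + n)) (Fin (m + n)) R :=
  (Matrix.reindexRingEquiv R finSumFinEquiv).toRingHom.comp
  { toFun := fun x => Matrix.fromBlocks x.1 0 0 x.2
    map_one' := by simp
    map_mul' := by simp [Matrix.fromBlocks_multiply]
    map_zero' := by simp
    map_add' := by simp [Matrix.fromBlocks_add] }

/-- The block matrix with only an upper right block. -/
def corner {R : Type*} [Ring R] {m n : ℕ} (t : Matrix (Fin m) (Fin n) R) :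
    Matrix (Fin (m + n)) (Fin (m + n)) R :=
  Matrix.reindexRingEquiv R finSumFinEquiv (Matrix.fromBlocks 0 t 0 0)

section corner
variable {m n : ℕ}
theorem dsum_mul_corner (x : Matrix (Fin m) (Fin m) E × Matrix (Fin n) (Fin n) E)
    (t : Matrix (Fin m) (Fin n) E) : dsum E m n x * corner t = corner (x.1 * t) := by
  simp only [dsum, corner]
  refine (map_mul (Matrix.reindexRingEquiv E finSumFinEquiv) _ _).symm.trans (congrArg _ ?_)
  exact (Matrix.fromBlocks_multiply ..).trans (by simp)

theorem corner_mul_dsum (x : Matrix (Fin m) (Fin m) E × Matrix (Fin n) (Fin n) E)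
    (t : Matrix (Fin m) (Fin n) E) : corner t * dsum E m n x = corner (t * x.2) := by
  simp only [dsum, corner]
  refine (map_mul (Matrix.reindexRingEquiv E finSumFinEquiv) _ _).symm.trans (congrArg _ ?_)
  exact (Matrix.fromBlocks_multiply ..).trans (by simp)

theorem corner_mul_corner (s t : Matrix (Fin m) (Fin n) E) : corner s * corner t = 0 := by
  simp only [corner]
  rw [← map_mul]
  simp [Matrix.fromBlocks_multiply]

theorem dsum_map (x : Matrix (Fin m) (Fin m) B × Matrix (Fin n) (Fin n) B) :
    (dsum B m n x).map ι = dsum E m n (x.1.map ι, x.2.map ι) := by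
  ext a b
  simp only [dsum, Matrix.map_apply]
  obtain ⟨a, rfl⟩ := finSumFinEquiv.surjective a
  obtain ⟨b, rfl⟩ := finSumFinEquiv.surjective b
  rcases a with a | a <;> rcases b with b | b <;> simp

theorem corner_map (t : Matrix (Fin m) (Fin n) B) : (corner t).map ι = corner (t.map ι) := by
  ext a b
  simp only [corner, Matrix.map_apply]
  obtain ⟨a, rfl⟩ := finSumFinEquiv.surjective a
  obtain ⟨b, rfl⟩ := finSumFinEquiv.surjective b
  rcases a with a | a <;> rcases b with b | b <;> simp

theorem dsum_scalar (x : E) : dsum E m n (Matrix.scalar _ x, Matrix.scalar _ x) =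
    Matrix.scalar _ x := by
  ext a b
  obtain ⟨a, rfl⟩ := finSumFinEquiv.surjective a
  obtain ⟨b, rfl⟩ := finSumFinEquiv.surjective b
  rcases a with a | a <;> rcases b with b | b <;>
    simp [dsum, Matrix.diagonal_apply, -finSumFinEquiv_apply_left, -finSumFinEquiv_apply_right]
end corner

/-- The inverse of a matrix whose second column was modified. -/
theorem inverse_perturb {S : Type*} [Ring S] (T₀ : GL2 S) (N : S)
    (h : T₀⁻¹.1 1 1 * N * T₀.1 0 1 * (T₀⁻¹.1 1 1 * N * T₀.1 0 1) = 0)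
    (T : Matrix (Fin 2) (Fin 2) S)
    (hT : T = !![T₀.1 0 0, T₀.1 0 1; T₀.1 1 0, N * T₀.1 0 1 + T₀.1 1 1]) :
    IsUnit T ∧ Ring.inverse T 1 1 =
      T₀⁻¹.1 1 1 - T₀⁻¹.1 1 1 * N * T₀.1 0 1 * T₀⁻¹.1 1 1 := by
  have e01 := congrFun (congrFun T₀.mul_inv 0) 1
  have e11 := congrFun (congrFun T₀.mul_inv 1) 1
  simp only [Matrix.mul_apply, Fin.sum_univ_two, Matrix.one_apply] at e01 e11
  norm_num at e01 e11
  set ζ := T₀⁻¹.1 1 1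
  set x := T₀⁻¹.1 0 1
  set β := T₀.1 0 1
  let y := ζ * N * β
  let U : GL2 S := ⟨!![1, x * N * β; 0, 1 + y], !![1, -(x * N * β) * (1 - y); 0, 1 - y],
    by
      rw [Matrix.mul_fin_two, Matrix.one_fin_two]
      have : (1 + y) * (1 - y) = 1 := by
        have : (1 + y) * (1 - y) = 1 - y * y := by noncomm_ring
        rw [this, h, sub_zero]
      simp [this],
    by
      rw [Matrix.mul_fin_two, Matrix.one_fin_two]
      have : (1 - y) * (1 + y) = 1 := by
        have : (1 - y) * (1 + y) = 1 - y * y := by noncomm_ring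
        rw [this, h, sub_zero]
      simp [this, mul_assoc]⟩
  have g0 : T₀.1 0 0 * (x * N * β) + β * y = 0 := by
    have : T₀.1 0 0 * (x * N * β) + β * y = (T₀.1 0 0 * x + β * ζ) * N * β := by
      simp only [y]; noncomm_ring
    rw [this, e01, zero_mul, zero_mul]
  have g1 : T₀.1 1 0 * (x * N * β) + T₀.1 1 1 * y = N * β := by
    have : T₀.1 1 0 * (x * N * β) + T₀.1 1 1 * y = (T₀.1 1 0 * x + T₀.1 1 1 * ζ) * N * β := by
      simp only [y]; noncomm_ring
    rw [this, e11, one_mul]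
  have hTU : T = (T₀ * U : GL2 S) := by
    have a0 : β = T₀.1 0 0 * (x * N * β) + β * (1 + y) := by
      rw [mul_add, mul_one, add_left_comm, g0, add_zero]
    have a1 : N * β + T₀.1 1 1 = T₀.1 1 0 * (x * N * β) + T₀.1 1 1 * (1 + y) := by
      rw [mul_add, mul_one, add_left_comm, g1, add_comm]
    rw [hT, Units.val_mul]
    ext a b
    fin_cases a <;> fin_cases b <;> simp [Matrix.mul_apply, Fin.sum_univ_two, U]
    · exact a0
    · exact a1
  refine ⟨hTU ▸ (T₀ * U).isUnit, ?_⟩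
  rw [hTU, Ring.inverse_unit, mul_inv_rev, Units.val_mul, Matrix.mul_apply, Fin.sum_univ_two]
  have a : U⁻¹.1 1 0 = 0 := rfl
  have b : U⁻¹.1 1 1 = 1 - y := rfl
  rw [a, b, zero_mul, zero_add, sub_mul, one_mul]

/-- A pair of elements of `GL(2)`, pushed forward entrywise. -/
def pairUnit {P Q S : Type*} [Ring P] [Ring Q] [Ring S] (f : P × Q →+* S) (g : GL2 P) (h : GL2 Q) :
    GL2 S where
  val := Matrix.of fun a b => f (g.1 a b, h.1 a b)
  inv := Matrix.of fun a b => f (g⁻¹.1 a b, h⁻¹.1 a b)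
  val_inv := by
    ext a b
    have h1 := congrFun (congrFun g.mul_inv a) b
    have h2 := congrFun (congrFun h.mul_inv a) b
    simp only [Matrix.mul_apply, Matrix.of_apply, ← map_mul, ← map_sum, Prod.mk_mul_mk] at h1 h2 ⊢
    rw [show ∑ c, (g.1 a c * g⁻¹.1 c b, h.1 a c * h⁻¹.1 c b) = ((1 : Matrix _ _ P) a b,
      (1 : Matrix _ _ Q) a b) from by rw [← h1, ← h2]; exact Prod.ext Prod.fst_sum Prod.snd_sum]
    simp only [Matrix.one_apply]
    split_ifs
    · exact map_one f
    · exact map_zero f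
  inv_val := by
    ext a b
    have h1 := congrFun (congrFun g.inv_mul a) b
    have h2 := congrFun (congrFun h.inv_mul a) b
    simp only [Matrix.mul_apply, Matrix.of_apply, ← map_mul, ← map_sum, Prod.mk_mul_mk] at h1 h2 ⊢
    rw [show ∑ c, (g⁻¹.1 a c * g.1 c b, h⁻¹.1 a c * h.1 c b) = ((1 : Matrix _ _ P) a b,
      (1 : Matrix _ _ Q) a b) from by rw [← h1, ← h2]; exact Prod.ext Prod.fst_sum Prod.snd_sum]
    simp only [Matrix.one_apply]
    split_ifs
    · exact map_one f
    · exact map_zero f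

/-- The set of matrix coefficients of resolvents is closed under multiplication. -/
theorem resolventCoeffs_mul (π : Gr E) {x y : E} (hx : x ∈ resolventCoeffs ι π)
    (hy : y ∈ resolventCoeffs ι π) : x * y ∈ resolventCoeffs ι π := by
  obtain ⟨m, σ', i, j, hσ', rfl⟩ := hx
  obtain ⟨n, σ'', k, l, hσ'', rfl⟩ := hy
  revert hσ' hσ''
  refine Quotient.inductionOn₃ π σ' σ'' fun p s' s'' => ?_
  intro hσ' hσ''
  obtain ⟨T', hT'⟩ : IsUnit (pairMatrix ι p s') := hσ'
  obtain ⟨T'', hT''⟩ : IsUnit (pairMatrix ι p s'') := hσ''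
  let t : Matrix (Fin m) (Fin n) E := Matrix.single j k 1
  have ht : (Matrix.single j k (1 : B)).map ι = t := by simp [t, Matrix.map_single]
  let T₀ : GL2 (Matrix (Fin (m + n)) (Fin (m + n)) E) := pairUnit (dsum E m n) T' T''
  let s₀ : GL2 (Matrix (Fin (m + n)) (Fin (m + n)) B) := pairUnit (dsum B m n) s' s''
  let L : GL2 (Matrix (Fin (m + n)) (Fin (m + n)) B) :=
    ⟨!![1, 0; corner (Matrix.single j k 1), 1], !![1, 0; -corner (Matrix.single j k 1), 1],
      by simp [Matrix.one_fin_two], by simp [Matrix.one_fin_two]⟩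
  have hβ : T₀.1 0 1 = dsum E m n ((s'.1 0 1).map ι, (s''.1 0 1).map ι) := by
    simp [T₀, pairUnit, hT', hT'', pairMatrix]
  have hζ : T₀⁻¹.1 1 1 = dsum E m n (T'⁻¹.1 1 1, T''⁻¹.1 1 1) := rfl
  have hy : T₀⁻¹.1 1 1 * corner t * T₀.1 0 1 =
      corner (T'⁻¹.1 1 1 * t * (s''.1 0 1).map ι) := by
    rw [hβ, hζ, dsum_mul_corner, corner_mul_dsum]
  have hT : pairMatrix ι p (L * s₀) =
      !![T₀.1 0 0, T₀.1 0 1; T₀.1 1 0, corner t * T₀.1 0 1 + T₀.1 1 1] := by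
    have l1 : (L * s₀).1 0 1 = dsum B m n (s'.1 0 1, s''.1 0 1) := by
      simp [L, Matrix.mul_apply, Fin.sum_univ_two, s₀, pairUnit]
    have l2 : (L * s₀).1 1 1 = corner (Matrix.single j k 1) * dsum B m n (s'.1 0 1, s''.1 0 1) +
        dsum B m n (s'.1 1 1, s''.1 1 1) := by
      simp [L, Matrix.mul_apply, Fin.sum_univ_two, s₀, pairUnit]
    rw [pairMatrix, l1, l2, Matrix.map_add _ (map_add ι), Matrix.map_mul, dsum_map, dsum_map, corner_map, ht, hβ]
    congr! 4
    · simp [T₀, pairUnit, hT', hT'', pairMatrix, ← dsum_scalar (m := m) (n := n)]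
    · simp [T₀, pairUnit, hT', hT'', pairMatrix, ← dsum_scalar (m := m) (n := n)]
    · simp [T₀, pairUnit, hT', hT'', pairMatrix]
  obtain ⟨hu, hinv⟩ := inverse_perturb T₀ (corner t)
    (by rw [hy, corner_mul_corner]) _ hT
  refine ⟨m + n, Gr.mk (L * s₀), finSumFinEquiv (Sum.inl i), finSumFinEquiv (Sum.inr l), hu, ?_⟩
  have r' : grResolvent ι (Gr.mk p) (Gr.mk s') = (s'.1 0 1).map ι * T'⁻¹.1 1 1 := by
    change (s'.1 0 1).map ι * Ring.inverse (pairMatrix ι p s') 1 1 = _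
    rw [← hT', Ring.inverse_unit]
  have r'' : grResolvent ι (Gr.mk p) (Gr.mk s'') = (s''.1 0 1).map ι * T''⁻¹.1 1 1 := by
    change (s''.1 0 1).map ι * Ring.inverse (pairMatrix ι p s'') 1 1 = _
    rw [← hT'', Ring.inverse_unit]
  have hR : grResolvent ι (Gr.mk p) (Gr.mk (L * s₀)) = dsum E m n
      (grResolvent ι (Gr.mk p) (Gr.mk s'), grResolvent ι (Gr.mk p) (Gr.mk s'')) -
      corner (grResolvent ι (Gr.mk p) (Gr.mk s') * t * grResolvent ι (Gr.mk p) (Gr.mk s'')) := by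
    change ((L * s₀).1 0 1).map ι * Ring.inverse (pairMatrix ι p (L * s₀)) 1 1 = _
    have l1 : ((L * s₀).1 0 1).map ι = T₀.1 0 1 := by
      rw [hβ]
      refine Eq.trans (congrArg (fun M => Matrix.map M ι) ?_) (dsum_map ι (s'.1 0 1, s''.1 0 1))
      simp [L, Matrix.mul_apply, Fin.sum_univ_two, s₀, pairUnit]
    rw [l1, hinv, hy, hβ, hζ, corner_mul_dsum, mul_sub, dsum_mul_corner, ← map_mul, r', r'']
    simp only [Prod.mk_mul_mk, Matrix.mul_assoc]
  change _ = (-grResolvent ι (Gr.mk p) (Gr.mk (L * s₀))) _ _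
  rw [hR]
  change (-grResolvent ι (Gr.mk p) (Gr.mk s')) i j * (-grResolvent ι (Gr.mk p) (Gr.mk s'')) k l = _
  simp [dsum, corner, t, Matrix.mul_apply, Matrix.single_apply, ite_and]

end Resolvent

section Algebras
variable {B E : Type*} [Ring B] [Ring E] [Algebra ℂ E] (ι : B →+* E)

/-- `LR(π; B)`: the linear span of the matrix coefficients of the resolvents, a (possibly
non-unital) subalgebra of `E`. -/
def resolventAlg (π : Gr E) : NonUnitalSubalgebra ℂ E where
  __ := Submodule.span ℂ (resolventCoeffs ι π)
  mul_mem' := by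
    intro x y hx hy
    have h := Submodule.mul_mem_mul (show x ∈ Submodule.span ℂ (resolventCoeffs ι π) from hx)
      (show y ∈ Submodule.span ℂ (resolventCoeffs ι π) from hy)
    rw [Submodule.span_mul_span] at h
    refine Submodule.span_mono ?_ h
    rintro _ ⟨a, ha, b, hb, rfl⟩
    exact resolventCoeffs_mul ι π ha hb

theorem grResolvent_mem (π : Gr E) {n : ℕ} {σ : Gr (Matrix (Fin n) (Fin n) B)}
    (hσ : σ ∈ grResolventSet ι (Fin n) π) (i j : Fin n) :
    grResolvent ι π σ i j ∈ resolventAlg ι π :=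
  neg_neg (grResolvent ι π σ i j) ▸
    neg_mem (show -grResolvent ι π σ i j ∈ resolventAlg ι π from
      Submodule.subset_span ⟨n, σ, i, j, hσ, rfl⟩)

/-- The inverse closed unital subalgebra of `E` generated by `s`. -/
def inverseClosedAlg (s : Set E) : Subalgebra ℂ E :=
  sInf {S | s ⊆ S ∧ ∀ x : Eˣ, (x : E) ∈ S → (↑x⁻¹ : E) ∈ S}
 
/-- `QR(π; B)`: the inverse closed subalgebra of `E` generated by `B ∪ LR(π; B)`. -/
def resolventQAlg (π : Gr E) : Subalgebra ℂ E :=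
  inverseClosedAlg (Set.range ι ∪ resolventAlg ι π)

theorem subset_inverseClosedAlg (s : Set E) : s ⊆ inverseClosedAlg s := by
  intro x hx
  simp only [inverseClosedAlg, Algebra.coe_sInf, Set.mem_iInter]
  exact fun S hS => hS.1 hx

/-- A matrix coefficient of a resolvent, as an element of `LR(π; B)`. -/
def coeff {π : Gr E} {n : ℕ} {σ : Gr (Matrix (Fin n) (Fin n) B)}
    (hσ : σ ∈ grResolventSet ι (Fin n) π) (i j : Fin n) : resolventAlg ι π :=
  ⟨grResolvent ι π σ i j, grResolvent_mem ι π hσ i j⟩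

/-- The inclusion `LR(π; B) ⊆ QR(π; B)`. -/
def resolventAlgToQ (π : Gr E) : resolventAlg ι π →ₗ[ℂ] resolventQAlg ι π where
  toFun x := ⟨x, subset_inverseClosedAlg _ (.inr x.2)⟩
  map_add' _ _ := rfl
  map_smul' _ _ := rfl

end Algebras

/-- `d : A → A ⊗ A` is a derivation for the bimodule structure `x (a ⊗ b) y = xa ⊗ by`, with the
algebraic tensor product over `ℂ`. -/
def IsTensorDerivation {A : Type*} [NonUnitalRing A] [Module ℂ A] [IsScalarTower ℂ A A]
    [SMulCommClass ℂ A A] (d : A →ₗ[ℂ] A ⊗[ℂ] A) : Prop :=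
  ∀ x y : A, d (x * y) =
    (LinearMap.mulLeft ℂ x).rTensor A (d y) + (LinearMap.mulRight ℂ y).lTensor A (d x)

section Universal
variable (B : Type u) [CStarAlgebra B]

/-- `E(B) = B * C(𝕋)`. -/
abbrev EAlg : Type u := FreeProd B C(Circle, ℂ)

/-- The inclusion of `B` in `E(B)`. -/
def inclB : B →+* EAlg B := (FreeProd.inl B C(Circle, ℂ) : B →+* EAlg B)

/-- The universal unitary: the image in `E(B)` of the inclusion function `𝕋 → ℂ`. -/
def univU : EAlg B := FreeProd.inr B C(Circle, ℂ) ⟨fun z => (z : ℂ), by fun_prop⟩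

/-- The universal unitary as an element of `Gr_1(E(B))`. -/
def univUGr : Gr (EAlg B) := Gr.graph (univU B)

/-- The matrix with rows `-i, i` and `1, 1`. -/
def cayley : GL2 ℂ :=
  ⟨!![-Complex.I, Complex.I; 1, 1], !![Complex.I / 2, 1 / 2; -Complex.I / 2, 1 / 2],
    by
      ext i j
      fin_cases i <;> fin_cases j <;> simp <;> ring_nf <;> norm_num,
    by
      ext i j
      fin_cases i <;> fin_cases j <;> simp <;> ring_nf <;> norm_num⟩

/-- The universal hermitian element `χ` of `Gr_1(E(B))`. -/
def univChi : Gr (EAlg B) :=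
  Gr.act (Units.map (algebraMap ℂ (EAlg B)).mapMatrix.toMonoidHom cayley) (univUGr B)

/-- `QR(u; B)`. -/
abbrev QRu : Subalgebra ℂ (EAlg B) := resolventQAlg (inclB B) (univUGr B)

/-- `LR(u; B)`. -/
abbrev LRu : NonUnitalSubalgebra ℂ (EAlg B) := resolventAlg (inclB B) (univUGr B)

/-- `LR(χ; B)`. -/
abbrev LRchi : NonUnitalSubalgebra ℂ (EAlg B) := resolventAlg (inclB B) (univChi B)

/-- An element of `B`, as an element of `QR(u; B)`. -/
def bToQ (b : B) : QRu B := ⟨inclB B b, subset_inverseClosedAlg _ (.inl ⟨b, rfl⟩)⟩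

/-- The map `LR(χ; B) → QR(u; B)` given by an inclusion of these subalgebras of `E(B)`. -/
def chiToQ (h : ∀ x ∈ LRchi B, x ∈ QRu B) : LRchi B →ₗ[ℂ] QRu B where
  toFun x := ⟨x, h x x.2⟩
  map_add' _ _ := rfl
  map_smul' _ _ := rfl

end Universal

end VoicFree

end

open VoicFree

noncomputable section

/-! The difficulty in (1) is that the derivation be well defined: an element of `QR(u; B)` can be
written in many ways from `B`, resolvents and inverses. Therefore `∂` is not defined on expressions
but is characterised by deformations. Let `ρ` be a representation of `E(B)` in a C⋆-algebra, and let
`φ t` be representations that agree with `ρ` on `B` and move `ρ u` with velocity `G`. A free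
difference quotient `w = ∑ a ⊗ b` of `x` must then satisfy `d/dt φ t x = ∑ ρ(a) G ρ(b)` at `t = 0`;
this is `IsFreeDerivative`.

Uniqueness: by the universal property, `ρ u` can be moved along `exp(itH) ρ(u)` for every
self-adjoint `H`, and by linearity in `H` the sum `∑ ρ(a) G ρ(b)` is determined by `x` for every
`G`. These sums separate the points of the algebraic tensor square: a GNS representation for two
positive functionals, with `G` of rank one, recovers all products `f(a) g(b)`, and positive
functionals separate points (`tensor_eq_zero_of_sandwich`, `tensor_eq_zero_of_isDeformation`).

Existence: the resolvent identity `R' - R = R' (Y' - Y) R` gives resolvent entries the quotient `∑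
k, R i k ⊗ R k j` (`IsFreeDerivative.of_resolvent_identity`). The elements with a quotient form an
inverse closed algebra, hence exhaust `QR(u; B)`. Linearity, the Leibniz rule and the values on
generators all follow from uniqueness.

For (2), the values on resolvent entries lie in the tensor square of `LR(u; B)`, which embeds in
that of `QR(u; B)` (`exists_resolventAlg_derivation`). For (3), `D` is `∂` followed by `a ⊗ b ↦ a u
b`; the resolvent identity gives `R u R` as the derivative along `e^t u`. For (4), scalar matrices
act on both arguments of a resolvent, so `R(χ)(ν) = (i/2)((1 - u) - (1 - u) R(u)(σ) (1 - u))` with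
`σ` the inverse Cayley transform of `ν` (`exists_grResolvent_cayley`). The twist by `1 - u` is a
bimodule map, and it turns the resolvent equation at `u` into the one at `χ`
(`cayleyTwist_resolvent`). -/

namespace VoicFree

/-! ### Separation of points in algebraic tensor squares of C⋆-algebras. -/

section Separation

open scoped ComplexOrder ComplexStarModule

/-- Positive functionals separate the points of a unital C⋆-algebra. -/
theorem exists_positive_apply_ne_zero {A : Type*} [CStarAlgebra A] [PartialOrder A]
    [StarOrderedRing A] {x : A} (hx : x ≠ 0) : ∃ f : A →ₚ[ℂ] ℂ, f x ≠ 0 := by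
  -- A self-adjoint element outside the positive cone is separated from it by a hyperplane; the
  -- separating functional is nonnegative on the cone and negative at `y`.
  have key : ∀ y : A, ¬ 0 ≤ y → IsSelfAdjoint y → ∃ f : A →ₚ[ℂ] ℂ, f y ≠ 0 := by
    intro y hy hys
    obtain ⟨f, hf, hfy⟩ := (ProperCone.positive ℝ A).hyperplane_separation_point (x₀ := y) hy
    -- The separating functional is only real linear. Composing with the real part makes it vanish
    -- on skew-adjoint elements, so that its complexification agrees with `f` on self-adjoint ones.
    let r : Module.Dual ℝ A := f.toLinearMap ∘ₗ (selfAdjoint.submodule ℝ A).subtype ∘ₗ realPart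
    have hr : ∀ z, IsSelfAdjoint z → r.extendRCLike (𝕜 := ℂ) z = f z := by
      intro z hz
      have h1 : ((ℜ z : selfAdjoint A) : A) = z := hz.coe_realPart
      have h2 : ((ℑ z : selfAdjoint A) : A) = 0 := by simp [hz.imaginaryPart]
      have h3 : r z = f z := congrArg f h1
      have h4 : r (Complex.I • z) = 0 := by
        change f ((ℜ (Complex.I • z) : selfAdjoint A) : A) = 0
        rw [realPart_I_smul, NegMemClass.coe_neg, h2, neg_zero, map_zero]
      simp [Module.Dual.extendRCLike_apply, h3, h4]
    refine ⟨PositiveLinearMap.mk₀ (r.extendRCLike (𝕜 := ℂ)) fun z hz => ?_, ?_⟩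
    · rw [hr z (IsSelfAdjoint.of_nonneg hz)]
      exact_mod_cast hf z hz
    · change r.extendRCLike (𝕜 := ℂ) y ≠ 0
      rw [hr y hys]
      exact_mod_cast hfy.ne
  -- If `y` is nonzero and positive, then `-y` is not positive, and the previous case applies to
  -- `-y`.
  have key' : ∀ y : A, y ≠ 0 → IsSelfAdjoint y → ∃ f : A →ₚ[ℂ] ℂ, f y ≠ 0 := by
    intro y hy hys
    by_cases h : 0 ≤ y
    · obtain ⟨f, hf⟩ := key (-y) (fun h' => hy (le_antisymm (neg_nonneg.1 h') h)) hys.neg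
      exact ⟨f, fun h' => hf (by rw [map_neg, h', neg_zero])⟩
    · exact key y h hys
  -- Positive functionals are real on self-adjoint elements, so `f x = 0` splits into its vanishing
  -- on the real and on the imaginary part of `x`.
  have real : ∀ (f : A →ₚ[ℂ] ℂ) (y : selfAdjoint A), (f y).im = 0 := fun f y =>
    Complex.conj_eq_iff_im.1 (by
      rw [← Complex.star_def, ← map_star, y.2.star_eq])
  by_contra! h
  have hre : ∀ f : A →ₚ[ℂ] ℂ, f (ℜ x : selfAdjoint A) = 0 ∧ f (ℑ x : selfAdjoint A) = 0 := by
    intro f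
    have := h f
    rw [← realPart_add_I_smul_imaginaryPart x, map_add, map_smul] at this
    have h1 := congrArg Complex.re this
    have h2 := congrArg Complex.im this
    simp [real] at h1 h2
    exact ⟨Complex.ext h1 (real _ _), Complex.ext h2 (real _ _)⟩
  apply hx
  rw [← realPart_add_I_smul_imaginaryPart x]
  have e1 : ((ℜ x : selfAdjoint A) : A) = 0 := by
    by_contra h'
    obtain ⟨f, hf⟩ := key' _ h' (ℜ x).2
    exact hf (hre f).1
  have e2 : ((ℑ x : selfAdjoint A) : A) = 0 := by
    by_contra h'
    obtain ⟨f, hf⟩ := key' _ h' (ℑ x).2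
    exact hf (hre f).2
  rw [e1, e2, smul_zero, add_zero]

/-- An element of an algebraic tensor product vanishes if all its slices by linear functionals
vanish. -/
theorem eq_zero_of_forall_dual_rTensor {K M N : Type*} [Field K] [AddCommGroup M] [Module K M]
    [AddCommGroup N] [Module K N] {w : M ⊗[K] N}
    (h : ∀ α : Module.Dual K M, TensorProduct.lid K N (α.rTensor N w) = 0) : w = 0 := by
  classical
  -- The coordinates of `w` along a basis of the left factor are slices by the coordinate
  -- functionals.
  let b := Module.Basis.ofVectorSpace K M
  refine (TensorProduct.equivFinsuppOfBasisLeft (N := N) b).map_eq_zero_iff.1 ?_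
  ext i
  rw [TensorProduct.equivFinsuppOfBasisLeft_apply, h, Finsupp.zero_apply]

/-- Products of positive functionals separate the points of the algebraic tensor square. -/
theorem tensor_eq_zero_of_positive {A : Type*} [CStarAlgebra A] [PartialOrder A]
    [StarOrderedRing A] {w : A ⊗[ℂ] A}
    (h : ∀ f g : A →ₚ[ℂ] ℂ, TensorProduct.lid ℂ ℂ
      (TensorProduct.map (f : A →ₗ[ℂ] ℂ) (g : A →ₗ[ℂ] ℂ) w) = 0) : w = 0 := by
  -- The factors are treated one at a time: first the slices by positive `g` vanish, and this then
  -- kills the slices by arbitrary `α` on the other side.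
  have slice : ∀ (g : A →ₚ[ℂ] ℂ), TensorProduct.rid ℂ A ((g : A →ₗ[ℂ] ℂ).lTensor A w) = 0 := by
    intro g
    by_contra h'
    obtain ⟨f, hf⟩ := exists_positive_apply_ne_zero h'
    refine hf ((h f g).symm ▸ ?_)
    have e : (f : A →ₗ[ℂ] ℂ) ∘ₗ (TensorProduct.rid ℂ A).toLinearMap ∘ₗ (g : A →ₗ[ℂ] ℂ).lTensor A =
        (TensorProduct.lid ℂ ℂ).toLinearMap ∘ₗ TensorProduct.map f g := by
      ext a b
      simp [mul_comm]
    exact LinearMap.congr_fun e w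
  refine eq_zero_of_forall_dual_rTensor fun α => ?_
  by_contra h'
  obtain ⟨g, hg⟩ := exists_positive_apply_ne_zero h'
  apply hg
  have e : (g : A →ₗ[ℂ] ℂ) ∘ₗ (TensorProduct.lid ℂ A).toLinearMap ∘ₗ α.rTensor A =
      α ∘ₗ (TensorProduct.rid ℂ A).toLinearMap ∘ₗ (g : A →ₗ[ℂ] ℂ).lTensor A := by
    ext a b
    simp [mul_comm]
  exact (LinearMap.congr_fun e w).trans ((congrArg α (slice g)).trans (map_zero α))

/-- The linear map `a ⊗ b ↦ ρ(a) G ρ(b)`. -/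
def sandwich {A C : Type*} [Ring A] [Algebra ℂ A] [Ring C] [Algebra ℂ C] (ρ : A →ₐ[ℂ] C) (G : C) :
    A ⊗[ℂ] A →ₗ[ℂ] C :=
  TensorProduct.lift (((LinearMap.mul ℂ C).comp
    ((LinearMap.mulRight ℂ G).comp ρ.toLinearMap)).compl₂ ρ.toLinearMap)

@[simp]
theorem sandwich_tmul {A C : Type*} [Ring A] [Algebra ℂ A] [Ring C] [Algebra ℂ C]
    (ρ : A →ₐ[ℂ] C) (G : C) (a b : A) : sandwich ρ G (a ⊗ₜ b) = ρ a * G * ρ b := by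
  simp [sandwich]

/-- The maps `a ⊗ b ↦ ρ(a) G ρ(b)`, for all representations `ρ` and all `G`, separate the points
of the algebraic tensor square of a C⋆-algebra. -/
theorem tensor_eq_zero_of_sandwich {A : Type u} [CStarAlgebra A] {w : A ⊗[ℂ] A}
    (h : ∀ (C : Type u) [CStarAlgebra C] (ρ : A →⋆ₐ[ℂ] C) (G : C),
      sandwich (ρ : A →ₐ[ℂ] C) G w = 0) : w = 0 := by
  let _ : PartialOrder A := CStarAlgebra.spectralOrder A
  have _ : StarOrderedRing A := CStarAlgebra.spectralOrderedRing A
  refine tensor_eq_zero_of_positive fun f g => ?_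
  -- The GNS space of `f ⊕ g` on `A × A` holds cyclic vectors for `f` and for `g` in one Hilbert
  -- space, on which `A` acts diagonally.
  let F : A × A →ₚ[ℂ] ℂ := PositiveLinearMap.mk₀
    ((f : A →ₗ[ℂ] ℂ).coprod (g : A →ₗ[ℂ] ℂ)) fun x hx => by
      have h1 := f.map_nonneg (show 0 ≤ x.1 from hx.1)
      have h2 := g.map_nonneg (show 0 ≤ x.2 from hx.2)
      simpa using add_nonneg h1 h2
  have hF : ∀ x, F x = f x.1 + g x.2 := fun x => by
    change ((f : A →ₗ[ℂ] ℂ).coprod (g : A →ₗ[ℂ] ℂ)) x = _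
    simp
  let ρ : A →⋆ₐ[ℂ] (F.GNS →L[ℂ] F.GNS) :=
    F.gnsStarAlgHom.comp ((StarAlgHom.id ℂ A).prod (StarAlgHom.id ℂ A))
  let e₁ : F.GNS := (F.toPreGNS (1, 0) : F.PreGNS)
  let e₂ : F.GNS := (F.toPreGNS (0, 1) : F.PreGNS)
  -- This operator sends `x` to `⟨e₂, x⟩ e₁`, whence `⟨e₁, ρ(a) G ρ(b) e₂⟩ = f(a) g(b)`.
  let G : F.GNS →L[ℂ] F.GNS := InnerProductSpace.rankOne ℂ e₁ e₂
  have hρ : ∀ (a : A) (x : F.PreGNS), ρ a (x : F.GNS) =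
      (F.toPreGNS ((a, a) * F.ofPreGNS x) : F.PreGNS) := by
    intro a x
    change F.gnsNonUnitalStarAlgHom (a, a) (x : F.GNS) = _
    rw [PositiveLinearMap.gnsNonUnitalStarAlgHom_apply_coe]
    rfl
  have h1 : ∀ a, inner ℂ e₁ (ρ a e₁) = f a := by
    intro a
    rw [hρ, UniformSpace.Completion.inner_coe, PositiveLinearMap.preGNS_inner_def, hF]
    simp
  have h2 : ∀ a, inner ℂ e₂ (ρ a e₂) = g a := by
    intro a
    rw [hρ, UniformSpace.Completion.inner_coe, PositiveLinearMap.preGNS_inner_def, hF]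
    simp
  let ev : (F.GNS →L[ℂ] F.GNS) →ₗ[ℂ] ℂ :=
    ((innerSL ℂ e₁).comp (ContinuousLinearMap.apply ℂ F.GNS e₂)).toLinearMap
  have e : ev ∘ₗ sandwich (ρ : A →ₐ[ℂ] _) G =
      (TensorProduct.lid ℂ ℂ).toLinearMap ∘ₗ TensorProduct.map (f : A →ₗ[ℂ] ℂ) (g : A →ₗ[ℂ] ℂ) := by
    ext a b
    have : ev (sandwich (ρ : A →ₐ[ℂ] _) G (a ⊗ₜ b)) = f a * g b := by
      rw [sandwich_tmul]
      change inner ℂ e₁ (ρ a (inner ℂ e₂ (ρ b e₂) • e₁)) = _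
      rw [map_smul, inner_smul_right, h1, h2, mul_comm]
    simpa using this
  have := LinearMap.congr_fun e w
  simp only [LinearMap.comp_apply] at this
  rw [h _ ρ G, map_zero] at this
  exact this.symm

end Separation

/-! ### Deformations of representations of `E(B)`. -/

section Deformation

variable {B : Type u} [CStarAlgebra B] {C : Type u} [CStarAlgebra C]

/-- A unitary element of a C⋆-algebra is the image of the inclusion function `𝕋 → ℂ` under a
⋆-homomorphism. -/
theorem exists_circle_starAlgHom {C : Type*} [CStarAlgebra C] {v : C} (hv : v ∈ unitary C) :
    ∃ g : C(Circle, ℂ) →⋆ₐ[ℂ] C, g ⟨fun z => (z : ℂ), by fun_prop⟩ = v := by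
  have hn : IsStarNormal v := ⟨by
    rw [commute_iff_eq, Unitary.star_mul_self_of_mem hv, Unitary.mul_star_self_of_mem hv]⟩
  -- The spectrum of a unitary lies on the circle, so a function on `𝕋` can be restricted to it
  -- before the functional calculus is applied.
  let s : C(spectrum ℂ v, Circle) :=
    ⟨fun z => ⟨z, spectrum.subset_circle_of_unitary hv z.2⟩, by fun_prop⟩
  refine ⟨(cfcHom hn).comp (s.compStarAlgHom' ℂ ℂ), ?_⟩
  exact cfcHom_id hn

/-- A family of representations of `E(B)` that agree with `ρ` on `B` and whose values at the
universal unitary have the derivative `G` at `ρ`. -/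
def IsDeformation (ρ : EAlg B →⋆ₐ[ℂ] C) (φ : ℝ → EAlg B →⋆ₐ[ℂ] C) (G : C) : Prop :=
  (∀ t b, φ t (inclB B b) = ρ (inclB B b)) ∧
    Filter.Tendsto (fun t => t⁻¹ • (φ t (univU B) - ρ (univU B))) (𝓝[≠] 0) (𝓝 G)

theorem univU_mem_unitary (B : Type u) [CStarAlgebra B] : univU B ∈ unitary (EAlg B) := by
  have h : (⟨fun z => (z : ℂ), by fun_prop⟩ : C(Circle, ℂ)) ∈ unitary C(Circle, ℂ) := by
    rw [Unitary.mem_iff]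
    constructor <;> ext z
    · exact (Complex.conj_mul' _).trans (by
        change (‖(z : ℂ)‖ : ℂ) ^ 2 = 1
        rw [Circle.norm_coe]
        simp)
    · exact (Complex.mul_conj' _).trans (by
        change (‖(z : ℂ)‖ : ℂ) ^ 2 = 1
        rw [Circle.norm_coe]
        simp)
  exact Unitary.map_mem (FreeProd.inr B C(Circle, ℂ)) h

/-- The path `exp(itH) ρ(u)` consists of unitaries, so the universal property extends each of its
points, together with `ρ` on `B`, to a representation of `E(B)`. Its velocity at `0` is `i H ρ(u)`.
-/
theorem exists_isDeformation (ρ : EAlg B →⋆ₐ[ℂ] C) {H : C} (hH : IsSelfAdjoint H) :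
    ∃ φ : ℝ → EAlg B →⋆ₐ[ℂ] C, IsDeformation ρ φ (Complex.I • H * ρ (univU B)) := by
  let w : ℝ → C := fun t => NormedSpace.exp (t • (Complex.I • H))
  have hw : ∀ t, w t ∈ unitary C := by
    intro t
    have : IsSelfAdjoint (t • H) := by
      rw [IsSelfAdjoint, star_smul, hH.star_eq, star_trivial]
    have h := (selfAdjoint.expUnitary ⟨t • H, this⟩).2
    rw [selfAdjoint.expUnitary_coe] at h
    rw [smul_comm] at h
    exact h
  have hu := Unitary.map_mem ρ (univU_mem_unitary B)
  choose g hg using fun t => exists_circle_starAlgHom (mul_mem (hw t) hu)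
  choose φ h1 h2 using fun t =>
    FreeProd.exists_lift (ρ.comp (FreeProd.inl B C(Circle, ℂ))) (g t)
  refine ⟨φ, fun t b => h1 t b, ?_⟩
  have hd : HasDerivAt (fun t : ℝ => w t * ρ (univU B)) (Complex.I • H * ρ (univU B)) 0 := by
    have := (hasDerivAt_exp_smul_const (𝕂 := ℝ) (Complex.I • H) 0).mul_const (ρ (univU B))
    simpa using this
  have := hd.tendsto_slope_zero
  refine this.congr fun t => ?_
  have : φ t (univU B) = w t * ρ (univU B) := (h2 t _).trans (hg t)
  rw [this]
  simp [w]

/-- The bilinear map `(H, w) ↦ ∑ ρ(a) H ρ(b)` is linear in `H`. -/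
theorem sandwich_add {A : Type*} [Ring A] [Algebra ℂ A] (ρ : A →ₐ[ℂ] C) (G H : C)
    (w : A ⊗[ℂ] A) : sandwich ρ (G + H) w = sandwich ρ G w + sandwich ρ H w := by
  induction w with
  | zero => simp
  | add x y hx hy => simp only [map_add, hx, hy]; abel
  | tmul a b => simp [mul_add, add_mul]

theorem sandwich_smul {A : Type*} [Ring A] [Algebra ℂ A] (ρ : A →ₐ[ℂ] C) (c : ℂ) (G : C)
    (w : A ⊗[ℂ] A) : sandwich ρ (c • G) w = c • sandwich ρ G w := by
  induction w with
  | zero => simp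
  | add x y hx hy => simp only [map_add, hx, hy, smul_add]
  | tmul a b => simp

/-- An element of the tensor square of `E(B)` is determined by its action on the derivatives of
deformations. -/
theorem tensor_eq_zero_of_isDeformation {w : EAlg B ⊗[ℂ] EAlg B}
    (h : ∀ (C : Type u) [CStarAlgebra C] (ρ : EAlg B →⋆ₐ[ℂ] C) (φ : ℝ → EAlg B →⋆ₐ[ℂ] C) (G : C),
      IsDeformation ρ φ G → sandwich (ρ : EAlg B →ₐ[ℂ] C) G w = 0) : w = 0 := by
  refine tensor_eq_zero_of_sandwich fun C _ ρ G => ?_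
  have key : ∀ H : C, IsSelfAdjoint H →
      sandwich (ρ : EAlg B →ₐ[ℂ] C) (H * ρ (univU B)) w = 0 := by
    intro H hH
    obtain ⟨φ, hφ⟩ := exists_isDeformation ρ hH
    have := h C ρ φ _ hφ
    rw [smul_mul_assoc, sandwich_smul] at this
    exact (smul_eq_zero.1 this).resolve_left Complex.I_ne_zero
  -- Only self-adjoint `H` come from deformations; real and imaginary parts give the rest by complex
  -- linearity.
  have all : ∀ H : C, sandwich (ρ : EAlg B →ₐ[ℂ] C) (H * ρ (univU B)) w = 0 := by
    intro H
    rw [← realPart_add_I_smul_imaginaryPart H, add_mul, smul_mul_assoc, sandwich_add,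
      sandwich_smul, key _ (realPart H).2, key _ (imaginaryPart H).2, smul_zero, add_zero]
  -- Since `ρ(u)` is unitary, `H = G ρ(u)⋆` makes the velocity `H ρ(u)` equal to `G`.
  have := all (G * star (ρ (univU B)))
  rwa [mul_assoc, Unitary.star_mul_self_of_mem (Unitary.map_mem ρ (univU_mem_unitary B)),
    mul_one] at this

end Deformation

/-! ### Free difference quotients: uniqueness and calculus rules. -/

section FreeDerivative

theorem sandwich_rTensor_mulLeft {A C : Type*} [Ring A] [Algebra ℂ A] [Ring C] [Algebra ℂ C]
    (ρ : A →ₐ[ℂ] C) (G : C) (x : A) (w : A ⊗[ℂ] A) :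
    sandwich ρ G ((LinearMap.mulLeft ℂ x).rTensor A w) = ρ x * sandwich ρ G w := by
  induction w with
  | zero => simp
  | add x y hx hy => simp only [map_add, hx, hy, mul_add]
  | tmul a b => simp [mul_assoc]

theorem sandwich_lTensor_mulRight {A C : Type*} [Ring A] [Algebra ℂ A] [Ring C] [Algebra ℂ C]
    (ρ : A →ₐ[ℂ] C) (G : C) (x : A) (w : A ⊗[ℂ] A) :
    sandwich ρ G ((LinearMap.mulRight ℂ x).lTensor A w) = sandwich ρ G w * ρ x := by
  induction w with
  | zero => simp
  | add x y hx hy => simp only [map_add, hx, hy, add_mul]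
  | tmul a b => simp [mul_assoc]

theorem tendsto_of_tendsto_slope {C : Type*} [NormedAddCommGroup C] [NormedSpace ℝ C] {a : ℝ → C}
    {b L : C} (h : Filter.Tendsto (fun t => t⁻¹ • (a t - b)) (𝓝[≠] 0) (𝓝 L)) :
    Filter.Tendsto (fun t => a t - b) (𝓝[≠] 0) (𝓝 0) := by
  have ht : Filter.Tendsto (fun t : ℝ => t) (𝓝[≠] 0) (𝓝 0) := nhdsWithin_le_nhds
  have := ht.smul h
  rw [zero_smul] at this
  refine this.congr' ?_
  filter_upwards [self_mem_nhdsWithin] with t ht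
  rw [smul_smul, mul_inv_cancel₀ ht, one_smul]

variable {B : Type u} [CStarAlgebra B]

/-- `w` is the free difference quotient of `x` with respect to the universal unitary: it gives the
derivatives at `x` of all deformations. -/
def IsFreeDerivative (x : EAlg B) (w : QRu B ⊗[ℂ] QRu B) : Prop :=
  ∀ (C : Type u) [CStarAlgebra C] (ρ : EAlg B →⋆ₐ[ℂ] C) (φ : ℝ → EAlg B →⋆ₐ[ℂ] C) (G : C),
    IsDeformation ρ φ G → Filter.Tendsto (fun t => t⁻¹ • (φ t x - ρ x)) (𝓝[≠] 0)
      (𝓝 (sandwich ((ρ : EAlg B →ₐ[ℂ] C).comp (QRu B).val) G w))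

namespace IsFreeDerivative

/-- Both candidates give the same limit for each deformation, so their difference is killed by all
sandwich maps at velocities. Over a field the tensor square of `QR(u; B)` embeds in that of `E(B)`,
where this forces the difference to vanish. -/
theorem unique {x : EAlg B} {w w' : QRu B ⊗[ℂ] QRu B} (h : IsFreeDerivative x w)
    (h' : IsFreeDerivative x w') : w = w' := by
  have hinj : Function.Injective (TensorProduct.map (QRu B).val.toLinearMap
      (QRu B).val.toLinearMap) :=
    TensorProduct.map_injective_of_flat_flat _ _ Subtype.val_injective Subtype.val_injective
  refine sub_eq_zero.1 (hinj ?_)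
  rw [map_zero]
  refine tensor_eq_zero_of_isDeformation fun C _ ρ φ G hφ => ?_
  have e : ∀ z, sandwich (ρ : EAlg B →ₐ[ℂ] C) G (TensorProduct.map (QRu B).val.toLinearMap
      (QRu B).val.toLinearMap z) = sandwich ((ρ : EAlg B →ₐ[ℂ] C).comp (QRu B).val) G z := by
    intro z
    induction z with
    | zero => simp
    | add x y hx hy => simp only [map_add, hx, hy]
    | tmul a b => simp
  rw [e, map_sub, sub_eq_zero]
  exact tendsto_nhds_unique (h C ρ φ G hφ) (h' C ρ φ G hφ)

theorem of_mem_range (b : B) : IsFreeDerivative (inclB B b) 0 := by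
  intro C _ ρ φ G hφ
  simp [hφ.1]

theorem univU : IsFreeDerivative (univU B) (1 ⊗ₜ 1) := by
  intro C _ ρ φ G hφ
  simpa using hφ.2

theorem add {x y : EAlg B} {w z : QRu B ⊗[ℂ] QRu B} (hx : IsFreeDerivative x w)
    (hy : IsFreeDerivative y z) : IsFreeDerivative (x + y) (w + z) := by
  intro C _ ρ φ G hφ
  rw [LinearMap.map_add]
  refine ((hx C ρ φ G hφ).add (hy C ρ φ G hφ)).congr fun t => ?_
  rw [map_add, map_add, ← smul_add]
  congr 1
  abel

theorem smul (c : ℂ) {x : EAlg B} {w : QRu B ⊗[ℂ] QRu B} (hx : IsFreeDerivative x w) :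
    IsFreeDerivative (c • x) (c • w) := by
  intro C _ ρ φ G hφ
  rw [LinearMap.map_smul]
  refine ((hx C ρ φ G hφ).const_smul c).congr fun t => ?_
  rw [map_smul, map_smul, ← smul_sub, smul_comm]

/-- This is the product rule from `φ(xy) - ρ(xy) = φ(x)(φ(y) - ρ(y)) + (φ(x) - ρ(x))ρ(y)`. It
produces exactly the bimodule structure in which `x` acts on the left leg and `y` on the right leg.
-/
theorem mul {x y : QRu B} {w z : QRu B ⊗[ℂ] QRu B} (hx : IsFreeDerivative (x : EAlg B) w)
    (hy : IsFreeDerivative (y : EAlg B) z) :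
    IsFreeDerivative ((x * y : QRu B) : EAlg B) ((LinearMap.mulLeft ℂ x).rTensor (QRu B) z +
      (LinearMap.mulRight ℂ y).lTensor (QRu B) w) := by
  intro C _ ρ φ G hφ
  rw [map_add, sandwich_rTensor_mulLeft, sandwich_lTensor_mulRight]
  have hx' : Filter.Tendsto (fun t => φ t x) (𝓝[≠] 0) (𝓝 (ρ x)) :=
    tendsto_sub_nhds_zero_iff.1 (tendsto_of_tendsto_slope (hx C ρ φ G hφ))
  refine ((hx'.mul (hy C ρ φ G hφ)).add ((hx C ρ φ G hφ).mul_const (ρ y))).congr fun t => ?_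
  rw [MulMemClass.coe_mul, map_mul, map_mul, mul_smul_comm, smul_mul_assoc, ← smul_add]
  congr 1
  noncomm_ring

/-- Matrices that satisfy the resolvent identity have a free difference quotient. -/
theorem of_resolvent_identity {n : Type*} [Fintype n] (R : Matrix n n (QRu B)) {v : EAlg B}
    {w : QRu B ⊗[ℂ] QRu B} (hv : IsFreeDerivative v w)
    (h : ∀ (C : Type u) [CStarAlgebra C] (ρ φ : EAlg B →⋆ₐ[ℂ] C),
      (∀ b, φ (inclB B b) = ρ (inclB B b)) → ∀ i j,
      φ (R i j) - ρ (R i j) = ∑ k, φ (R i k) * (φ v - ρ v) * ρ (R k j)) (i j : n) :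
    IsFreeDerivative (R i j : EAlg B) (∑ k, (LinearMap.mulLeft ℂ (R i k)).rTensor (QRu B)
      ((LinearMap.mulRight ℂ (R k j)).lTensor (QRu B) w)) := by
  intro C _ ρ φ G hφ
  have hv' := hv C ρ φ G hφ
  have hv0 := tendsto_of_tendsto_slope hv'
  have hR : ∀ k, Filter.Tendsto (fun t => φ t (R i k)) (𝓝[≠] 0) (𝓝 (ρ (R i k))) := by
    intro k
    rw [← tendsto_sub_nhds_zero_iff]
    have : Filter.Tendsto (fun t => ∑ l, φ t (R i l) * (φ t v - ρ v) * ρ (R l k)) (𝓝[≠] 0)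
        (𝓝 (∑ l : n, 0 * ρ (R l k))) := by
      refine tendsto_finsetSum _ fun l _ => Filter.Tendsto.mul_const _ ?_
      -- Continuity of `φ t (R i k)` at `0` is not assumed: ⋆-homomorphisms are contractive, so the
      -- left factor stays bounded while `φ t v - ρ v` tends to `0`.
      refine Filter.isBoundedUnder_le_mul_tendsto_zero
        (Filter.isBoundedUnder_of ⟨‖(R i l : EAlg B)‖, fun t => ?_⟩) hv0
      exact NonUnitalStarAlgHom.norm_apply_le (φ t) _
    simp only [zero_mul, Finset.sum_const_zero] at this
    exact this.congr fun t => (h C ρ (φ t) (hφ.1 t) i k).symm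
  rw [map_sum]
  simp only [sandwich_rTensor_mulLeft, sandwich_lTensor_mulRight]
  refine Filter.Tendsto.congr (fun t => ?_)
    (tendsto_finsetSum _ fun k _ => (hR k).mul (hv'.mul_const (ρ (R k j))))
  rw [h C ρ (φ t) (hφ.1 t), Finset.smul_sum]
  refine Finset.sum_congr rfl fun k _ => ?_
  rw [smul_mul_assoc, mul_smul_comm, mul_assoc]

/-- As a 1 × 1 matrix, `x⁻¹` satisfies the resolvent identity with `v = -x`, because `φ(x⁻¹) -
ρ(x⁻¹) = -φ(x⁻¹)(φ(x) - ρ(x))ρ(x⁻¹)`. -/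
theorem inv {x : (EAlg B)ˣ} (hx : (↑x⁻¹ : EAlg B) ∈ QRu B) {w : QRu B ⊗[ℂ] QRu B}
    (h : IsFreeDerivative (x : EAlg B) w) : ∃ w', IsFreeDerivative (↑x⁻¹ : EAlg B) w' := by
  have key : ∀ (C : Type u) [CStarAlgebra C] (ρ φ : EAlg B →⋆ₐ[ℂ] C),
      φ (↑x⁻¹ : EAlg B) - ρ (↑x⁻¹ : EAlg B) = φ (↑x⁻¹ : EAlg B) *
        (φ ((-1 : ℂ) • (x : EAlg B)) - ρ ((-1 : ℂ) • (x : EAlg B))) * ρ (↑x⁻¹ : EAlg B) := by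
    intro C _ ρ φ
    have h1 : φ (↑x⁻¹ : EAlg B) * φ x = 1 := by rw [← map_mul, Units.inv_mul, map_one]
    have h2 : ρ x * ρ (↑x⁻¹ : EAlg B) = 1 := by rw [← map_mul, Units.mul_inv, map_one]
    rw [neg_one_smul, map_neg, map_neg, mul_sub, mul_neg, h1, sub_mul, mul_assoc,
      neg_mul (ρ (x : EAlg B)), h2]
    noncomm_ring
  let R : Matrix Unit Unit (QRu B) := fun _ _ => ⟨↑x⁻¹, hx⟩
  have := of_resolvent_identity R (h.smul (-1)) (fun C _ ρ φ _ i j => by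
    rw [Fintype.sum_unique]
    exact key C ρ φ) () ()
  exact ⟨_, this⟩

end IsFreeDerivative

end FreeDerivative

/-! ### Resolvents of graphs and the resolvent identity. -/

section GraphResolvent

/-- The Schur complement of the entry `1` is `d - y * b`. For the graph of `Y` this replaces the
block matrix by the pencil `δ - Yβ`. -/
theorem isUnit_graphPair_iff {S : Type*} [Ring S] (y b d : S) :
    IsUnit !![1, b; y, d] ↔ IsUnit (d - y * b) := by
  constructor
  · rintro ⟨P, hP⟩
    have e01 := congrFun (congrFun P.mul_inv 0) 1
    have e11 := congrFun (congrFun P.mul_inv 1) 1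
    have f10 := congrFun (congrFun P.inv_mul 1) 0
    have f11 := congrFun (congrFun P.inv_mul 1) 1
    simp only [Matrix.mul_apply, Fin.sum_univ_two, hP, Matrix.of_apply, Matrix.cons_val_zero,
      Matrix.cons_val_one, Matrix.one_apply] at e01 e11 f10 f11
    norm_num at e01 e11 f10 f11
    refine ⟨⟨d - y * b, P⁻¹.1 1 1, ?_, ?_⟩, rfl⟩
    · rw [sub_mul, mul_assoc, ← e11, sub_eq_iff_eq_add, add_comm _ (y * (b * _)), ← add_assoc,
        ← mul_add, add_comm (b * _), e01, mul_zero, zero_add]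
    · rw [mul_sub, ← f11, sub_eq_iff_eq_add, add_comm _ (_ * (y * b)), ← add_assoc, ← mul_assoc,
        ← add_mul, add_comm (_ * y), f10, zero_mul, zero_add]
  · rintro ⟨z, hz⟩
    have hd : d = y * b + z := by rw [hz]; abel
    refine ⟨⟨!![1, b; y, d], !![1 + b * z⁻¹.1 * y, -(b * z⁻¹.1); -(z⁻¹.1 * y), z⁻¹.1],
      ?_, ?_⟩, rfl⟩
    · rw [hd, Matrix.mul_fin_two, Matrix.one_fin_two]
      congr! 3 <;> simp [mul_add, add_mul, ← mul_assoc]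
      abel
    · rw [hd, Matrix.mul_fin_two, Matrix.one_fin_two]
      congr! 3 <;> simp [mul_add, add_mul, mul_assoc]

theorem inverse_graphPair {S : Type*} [Ring S] (y b d : S) :
    Ring.inverse !![1, b; y, d] 1 1 = Ring.inverse (d - y * b) := by
  by_cases h : IsUnit (d - y * b)
  · obtain ⟨P, hP⟩ := (isUnit_graphPair_iff y b d).2 h
    rw [← hP, Ring.inverse_unit]
    have e01 := congrFun (congrFun P.mul_inv 0) 1
    have e11 := congrFun (congrFun P.mul_inv 1) 1
    simp only [Matrix.mul_apply, Fin.sum_univ_two, hP, Matrix.of_apply, Matrix.cons_val_zero,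
      Matrix.cons_val_one, Matrix.one_apply] at e01 e11
    norm_num at e01 e11
    have : (d - y * b) * P⁻¹.1 1 1 = 1 := by
      rw [sub_mul, mul_assoc, ← e11, sub_eq_iff_eq_add, add_comm _ (y * (b * _)), ← add_assoc,
        ← mul_add, add_comm (b * _), e01, mul_zero, zero_add]
    have h' := congrArg (Ring.inverse (d - y * b) * ·) this
    simp only [← mul_assoc, Ring.inverse_mul_cancel _ h, one_mul, mul_one] at h'
    exact h'
  · rw [Ring.inverse_non_unit _ h, Ring.inverse_non_unit _ (by rwa [isUnit_graphPair_iff])]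
    rfl

variable {B E : Type*} [Ring B] [Ring E] (ι : B →+* E) {n : Type*} [Fintype n] [DecidableEq n]

/-- The matrix `δ - Yβ`. -/
def graphPencil (Y : E) (s : GL2 (Matrix n n B)) : Matrix n n E :=
  (s.1 1 1).map ι - Matrix.scalar n Y * (s.1 0 1).map ι

theorem mem_grResolventSet_graph (Y : E) (s : GL2 (Matrix n n B)) :
    Gr.mk s ∈ grResolventSet ι n (Gr.graph Y) ↔ IsUnit (graphPencil ι Y s) := by
  rw [graphPencil, ← isUnit_graphPair_iff]
  change IsUnit (pairMatrix ι _ s) ↔ _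
  simp [pairMatrix]

theorem grResolvent_graph (Y : E) (s : GL2 (Matrix n n B)) :
    grResolvent ι (Gr.graph Y) (Gr.mk s) =
      (s.1 0 1).map ι * Ring.inverse (graphPencil ι Y s) := by
  rw [graphPencil, ← inverse_graphPair]
  change _ * Ring.inverse (pairMatrix ι _ s) 1 1 = _
  simp [pairMatrix]

/-- The resolvent identity. -/
theorem grResolvent_graph_sub {Y Y' : E} {σ : Gr (Matrix n n B)}
    (h : σ ∈ grResolventSet ι n (Gr.graph Y)) (h' : σ ∈ grResolventSet ι n (Gr.graph Y')) :
    grResolvent ι (Gr.graph Y') σ - grResolvent ι (Gr.graph Y) σ =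
      grResolvent ι (Gr.graph Y') σ * Matrix.scalar n (Y' - Y) * grResolvent ι (Gr.graph Y) σ := by
  induction σ using Quotient.inductionOn with | _ s => ?_
  have h := (mem_grResolventSet_graph ι Y s).1 h
  have h' := (mem_grResolventSet_graph ι Y' s).1 h'
  change grResolvent ι (Gr.graph Y') (Gr.mk s) - grResolvent ι (Gr.graph Y) (Gr.mk s) =
      grResolvent ι (Gr.graph Y') (Gr.mk s) * _ * grResolvent ι (Gr.graph Y) (Gr.mk s)
  rw [grResolvent_graph, grResolvent_graph]
  -- The numerator `β` inside the product turns `Y' - Y` into a difference of pencils, which cancels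
  -- against the two inverses.
  have e : Matrix.scalar n (Y' - Y) * (s.1 0 1).map ι = graphPencil ι Y s - graphPencil ι Y' s := by
    rw [map_sub, sub_mul, graphPencil, graphPencil]; abel
  rw [mul_assoc, ← mul_assoc _ ((s.1 0 1).map ι), e, mul_assoc, ← mul_assoc (Ring.inverse _),
    mul_sub, sub_mul, Ring.inverse_mul_cancel _ h', mul_assoc _ _ (Ring.inverse _),
    Ring.mul_inverse_cancel _ h, mul_sub]
  simp

/-- Resolvents are compatible with ring homomorphisms. -/
theorem map_grResolvent_graph {F : Type*} [Ring F] (φ : E →+* F) {Y : E} {σ : Gr (Matrix n n B)}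
    (h : σ ∈ grResolventSet ι n (Gr.graph Y)) :
    σ ∈ grResolventSet (φ.comp ι) n (Gr.graph (φ Y)) ∧
      grResolvent (φ.comp ι) (Gr.graph (φ Y)) σ = (grResolvent ι (Gr.graph Y) σ).map φ := by
  induction σ using Quotient.inductionOn with | _ s => ?_
  obtain ⟨z, hz⟩ := (mem_grResolventSet_graph ι Y s).1 h
  have e : graphPencil (φ.comp ι) (φ Y) s =
      (Units.map φ.mapMatrix.toMonoidHom z : (Matrix n n F)ˣ) := by
    change _ = φ.mapMatrix z.1
    rw [hz, graphPencil, graphPencil, map_sub, map_mul]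
    congr 2
    ext i j
    by_cases hij : i = j <;> simp [hij]
  constructor
  · refine (mem_grResolventSet_graph _ _ s).2 ?_
    rw [e]
    exact Units.isUnit _
  · refine (grResolvent_graph _ _ s).trans (Eq.trans ?_
      (congrArg (fun M => Matrix.map M φ) (grResolvent_graph ι Y s).symm))
    rw [e, Ring.inverse_unit, ← hz, Ring.inverse_unit]
    refine Eq.trans ?_ (map_mul φ.mapMatrix ((s.1 0 1).map ι) z⁻¹.1).symm
    rfl

end GraphResolvent

/-! ### Resolvent algebras and restriction of derivations. -/

section ResolventAlgebras

variable {B E : Type*} [Ring B] [Ring E] [Algebra ℂ E] (ι : B →+* E)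

theorem inv_mem_inverseClosedAlg {s : Set E} {x : Eˣ} (hx : (x : E) ∈ inverseClosedAlg s) :
    (↑x⁻¹ : E) ∈ inverseClosedAlg s := by
  simp only [inverseClosedAlg, Algebra.mem_sInf] at hx ⊢
  exact fun S hS => hS.2 x (hx S hS)

theorem submodule_eq_top_of_coeff_mem {π : Gr E} (P : Submodule ℂ (resolventAlg ι π))
    (h : ∀ (n : ℕ) (σ : Gr (Matrix (Fin n) (Fin n) B)) (hσ : σ ∈ grResolventSet ι (Fin n) π)
      (i j : Fin n), coeff ι hσ i j ∈ P) : P = ⊤ := by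
  rw [eq_top_iff]
  rintro ⟨x, hx⟩ -
  have hx' : x ∈ Submodule.span ℂ (resolventCoeffs ι π) := hx
  induction hx' using Submodule.span_induction with
  | mem x h' =>
    obtain ⟨n, σ, i, j, hσ, rfl⟩ := h'
    exact P.neg_mem (h n σ hσ i j)
  | zero => exact P.zero_mem
  | add x y hx' hy' h1 h2 => exact P.add_mem (h1 hx') (h2 hy')
  | smul a x hx' h1 => exact P.smul_mem a (h1 hx')

/-- A derivation along an embedding that has its values in the image of the tensor square
restricts. -/
theorem exists_isTensorDerivation {L A : Type*} [NonUnitalRing L] [Module ℂ L]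
    [IsScalarTower ℂ L L] [SMulCommClass ℂ L L] [Ring A] [Algebra ℂ A] (j : L →ₗ[ℂ] A)
    (hj : Function.Injective j) (hmul : ∀ x y, j (x * y) = j x * j y) (d : L →ₗ[ℂ] A ⊗[ℂ] A)
    (hd : ∀ x y, d (x * y) = (LinearMap.mulLeft ℂ (j x)).rTensor A (d y) +
      (LinearMap.mulRight ℂ (j y)).lTensor A (d x))
    (hr : ∀ x, d x ∈ LinearMap.range (TensorProduct.map j j)) :
    ∃ d' : L →ₗ[ℂ] L ⊗[ℂ] L, IsTensorDerivation d' ∧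
      ∀ x, TensorProduct.map j j (d' x) = d x := by
  have hinj : Function.Injective (TensorProduct.map j j) :=
    TensorProduct.map_injective_of_flat_flat j j hj hj
  -- A linear left inverse exists over a field; the choice is immaterial, since `d` takes its values
  -- in the range.
  obtain ⟨g, hg⟩ := LinearMap.exists_leftInverse_of_injective _ (LinearMap.ker_eq_bot.2 hinj)
  have key : ∀ x, TensorProduct.map j j ((g ∘ₗ d) x) = d x := by
    intro x
    obtain ⟨z, hz⟩ := hr x
    rw [LinearMap.comp_apply, ← hz]
    exact congrArg _ (LinearMap.congr_fun hg z)
  refine ⟨g ∘ₗ d, fun x y => hinj ?_, key⟩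
  have e1 : ∀ z, TensorProduct.map j j ((LinearMap.mulLeft ℂ x).rTensor L z) =
      (LinearMap.mulLeft ℂ (j x)).rTensor A (TensorProduct.map j j z) := by
    intro z
    induction z with
    | zero => simp
    | add a b ha hb => simp only [map_add, ha, hb]
    | tmul a b => simp [hmul]
  have e2 : ∀ z, TensorProduct.map j j ((LinearMap.mulRight ℂ y).lTensor L z) =
      (LinearMap.mulRight ℂ (j y)).lTensor A (TensorProduct.map j j z) := by
    intro z
    induction z with
    | zero => simp
    | add a b ha hb => simp only [map_add, ha, hb]
    | tmul a b => simp [hmul]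
  rw [key, hd, map_add, e1, e2, key, key]

/-- A derivation along an embedding of `LR(π; B)` that satisfies the resolvent equation restricts
to `LR(π; B)`. -/
theorem exists_resolventAlg_derivation {π : Gr E} {A : Type*} [Ring A] [Algebra ℂ A]
    (j : resolventAlg ι π →ₗ[ℂ] A) (hj : Function.Injective j)
    (hmul : ∀ x y, j (x * y) = j x * j y) (d : resolventAlg ι π →ₗ[ℂ] A ⊗[ℂ] A)
    (hd : ∀ x y, d (x * y) = (LinearMap.mulLeft ℂ (j x)).rTensor A (d y) +
      (LinearMap.mulRight ℂ (j y)).lTensor A (d x))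
    (hc : ∀ (n : ℕ) (σ : Gr (Matrix (Fin n) (Fin n) B)) (hσ : σ ∈ grResolventSet ι (Fin n) π)
      (i l : Fin n), d (coeff ι hσ i l) = ∑ k, j (coeff ι hσ i k) ⊗ₜ[ℂ] j (coeff ι hσ k l)) :
    ∃ d' : resolventAlg ι π →ₗ[ℂ] resolventAlg ι π ⊗[ℂ] resolventAlg ι π,
      IsTensorDerivation d' ∧
      (∀ (n : ℕ) (σ : Gr (Matrix (Fin n) (Fin n) B)) (hσ : σ ∈ grResolventSet ι (Fin n) π)
        (i l : Fin n), d' (coeff ι hσ i l) = ∑ k, coeff ι hσ i k ⊗ₜ[ℂ] coeff ι hσ k l) ∧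
      ∀ x, TensorProduct.map j j (d' x) = d x := by
  have hc' : ∀ (n : ℕ) (σ : Gr (Matrix (Fin n) (Fin n) B)) (hσ : σ ∈ grResolventSet ι (Fin n) π)
      (i l : Fin n), TensorProduct.map j j (∑ k, coeff ι hσ i k ⊗ₜ[ℂ] coeff ι hσ k l) =
        d (coeff ι hσ i l) := by
    intro n σ hσ i l
    rw [hc, map_sum]
    simp only [TensorProduct.map_tmul]
  have hr : (LinearMap.range (TensorProduct.map j j)).comap d = ⊤ :=
    submodule_eq_top_of_coeff_mem _ _ fun n σ hσ i l => ⟨_, hc' n σ hσ i l⟩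
  obtain ⟨d', h1, h2⟩ := exists_isTensorDerivation j hj hmul d hd
    (fun x => Submodule.eq_top_iff'.1 hr x)
  refine ⟨d', h1, fun n σ hσ i l => ?_, h2⟩
  exact TensorProduct.map_injective_of_flat_flat j j hj hj ((h2 _).trans (hc' n σ hσ i l).symm)

theorem resolventAlgToQ_injective (π : Gr E) : Function.Injective (resolventAlgToQ ι π) :=
  fun _ _ h => Subtype.ext (congrArg (fun z : resolventQAlg ι π => (z : E)) h)

end ResolventAlgebras

/-! ### The free difference quotient derivation on `QR(u; B)`. -/

section FreeDerivation

variable (B : Type u) [CStarAlgebra B]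

variable {B} in
theorem isFreeDerivative_coeff {n : ℕ} {σ : Gr (Matrix (Fin n) (Fin n) B)}
    (hσ : σ ∈ grResolventSet (inclB B) (Fin n) (univUGr B)) (i j : Fin n) :
    IsFreeDerivative (coeff (inclB B) hσ i j : EAlg B)
      (∑ k, resolventAlgToQ _ _ (coeff (inclB B) hσ i k) ⊗ₜ[ℂ]
        resolventAlgToQ _ _ (coeff (inclB B) hσ k j)) := by
  have h := IsFreeDerivative.of_resolvent_identity
    (fun i j => resolventAlgToQ _ _ (coeff (inclB B) hσ i j)) IsFreeDerivative.univU
    (fun C _ ρ φ hb i j => by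
      obtain ⟨h1, h2⟩ := map_grResolvent_graph (inclB B) (ρ : EAlg B →+* C) hσ
      obtain ⟨h3, h4⟩ := map_grResolvent_graph (inclB B) (φ : EAlg B →+* C) hσ
      -- Agreement on `B` makes the two images resolvents over the same map `B → C`, at the points
      -- `ρ(u)` and `φ(u)`, so that the resolvent identity compares them.
      have e : (φ : EAlg B →+* C).comp (inclB B) = (ρ : EAlg B →+* C).comp (inclB B) :=
        RingHom.ext hb
      rw [e] at h3 h4
      have := congrFun (congrFun (grResolvent_graph_sub _ h1 h3) i) j
      rw [h2, h4] at this
      simp [Matrix.mul_apply, Matrix.diagonal_apply] at this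
      exact this) i j
  simp at h
  exact h

/-- The elements of `QR(u; B)` that have a free difference quotient. -/
def freeDerivativeAlg : Subalgebra ℂ (EAlg B) where
  carrier := {x | x ∈ QRu B ∧ ∃ w, IsFreeDerivative x w}
  mul_mem' := by
    rintro x y ⟨hx, w, hw⟩ ⟨hy, z, hz⟩
    exact ⟨mul_mem hx hy, _, IsFreeDerivative.mul (x := ⟨x, hx⟩) (y := ⟨y, hy⟩) hw hz⟩
  add_mem' := by
    rintro x y ⟨hx, w, hw⟩ ⟨hy, z, hz⟩
    exact ⟨add_mem hx hy, _, hw.add hz⟩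
  algebraMap_mem' c := by
    refine ⟨Subalgebra.algebraMap_mem _ c, 0, ?_⟩
    have h := IsFreeDerivative.of_mem_range (algebraMap ℂ B c)
    have e : inclB B (algebraMap ℂ B c) = algebraMap ℂ (EAlg B) c :=
      AlgHomClass.commutes (FreeProd.inl B C(Circle, ℂ)) c
    rwa [e] at h

/-- `QR(u; B)` is the least inverse closed algebra containing its generators, so it suffices that
elements of `B` and of `LR(u; B)` have a free difference quotient and that inverses inherit one. -/
theorem resolventQAlg_le_freeDerivativeAlg : QRu B ≤ freeDerivativeAlg B := by
  refine sInf_le ⟨?_, fun x hx => ?_⟩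
  · rintro _ (⟨b, rfl⟩ | hx)
    · exact ⟨(bToQ B b).2, 0, IsFreeDerivative.of_mem_range b⟩
    · have h : (Subalgebra.toSubmodule (freeDerivativeAlg B)).comap
          ((QRu B).val.toLinearMap ∘ₗ resolventAlgToQ (inclB B) (univUGr B)) = ⊤ :=
        submodule_eq_top_of_coeff_mem _ _ fun n σ hσ i j =>
          ⟨(resolventAlgToQ _ _ (coeff _ hσ i j)).2, _, isFreeDerivative_coeff hσ i j⟩
      exact (Submodule.eq_top_iff'.1 h ⟨_, hx⟩ : _)
  · obtain ⟨h1, w, hw⟩ := hx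
    exact ⟨inv_mem_inverseClosedAlg h1, hw.inv (inv_mem_inverseClosedAlg h1)⟩

variable {B} in
theorem exists_isFreeDerivative (x : QRu B) : ∃ w, IsFreeDerivative (x : EAlg B) w :=
  (resolventQAlg_le_freeDerivativeAlg B x.2).2

/-- The free difference quotient derivation of `QR(u; B)`. -/
def freeDerivation : QRu B →ₗ[ℂ] QRu B ⊗[ℂ] QRu B where
  toFun x := (exists_isFreeDerivative x).choose
  map_add' x y := (exists_isFreeDerivative (x + y)).choose_spec.unique
    ((exists_isFreeDerivative x).choose_spec.add (exists_isFreeDerivative y).choose_spec)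
  map_smul' c x := (exists_isFreeDerivative (c • x)).choose_spec.unique
    ((exists_isFreeDerivative x).choose_spec.smul c)

variable {B}

theorem isFreeDerivative_freeDerivation (x : QRu B) :
    IsFreeDerivative (x : EAlg B) (freeDerivation B x) :=
  (exists_isFreeDerivative x).choose_spec

theorem freeDerivation_eq {x : QRu B} {w : QRu B ⊗[ℂ] QRu B}
    (h : IsFreeDerivative (x : EAlg B) w) : freeDerivation B x = w :=
  (isFreeDerivative_freeDerivation x).unique h

theorem isTensorDerivation_freeDerivation : IsTensorDerivation (freeDerivation B) := fun x y =>
  freeDerivation_eq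
    ((isFreeDerivative_freeDerivation x).mul (isFreeDerivative_freeDerivation y))

theorem freeDerivation_coeff {n : ℕ} {σ : Gr (Matrix (Fin n) (Fin n) B)}
    (hσ : σ ∈ grResolventSet (inclB B) (Fin n) (univUGr B)) (i j : Fin n) :
    freeDerivation B (resolventAlgToQ _ _ (coeff _ hσ i j)) =
      ∑ k, resolventAlgToQ _ _ (coeff _ hσ i k) ⊗ₜ[ℂ] resolventAlgToQ _ _ (coeff _ hσ k j) :=
  freeDerivation_eq (isFreeDerivative_coeff hσ i j)

theorem univU_mem_resolventQAlg (B : Type u) [CStarAlgebra B] : univU B ∈ QRu B := by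
  -- For `β = 1`, `δ = 0` the pencil is `-u` and the resolvent is `-u⁻¹`; inverse closedness then
  -- gives `u` itself.
  let s : GL2 (Matrix (Fin 1) (Fin 1) B) :=
    ⟨!![0, 1; 1, 0], !![0, 1; 1, 0], by simp [Matrix.one_fin_two], by simp [Matrix.one_fin_two]⟩
  let x : (EAlg B)ˣ := Unitary.toUnits ⟨univU B, univU_mem_unitary B⟩
  let z : (Matrix (Fin 1) (Fin 1) (EAlg B))ˣ :=
    -Units.map (Matrix.scalar (Fin 1) : EAlg B →+* _).toMonoidHom x
  have hz : graphPencil (inclB B) (univU B) s = z := by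
    simp [graphPencil, s, z, x]
  have hs : Gr.mk s ∈ grResolventSet (inclB B) (Fin 1) (univUGr B) := by
    rw [univUGr, mem_grResolventSet_graph, hz]
    exact z.isUnit
  have hR : grResolvent (inclB B) (univUGr B) (Gr.mk s) 0 0 = -(↑x⁻¹ : EAlg B) := by
    rw [univUGr, grResolvent_graph, hz, Ring.inverse_unit]
    simp [s, z]
  have hmem : (↑x⁻¹ : EAlg B) ∈ QRu B := by
    have := (resolventAlgToQ _ _ (coeff _ hs 0 0)).2
    change grResolvent (inclB B) (univUGr B) (Gr.mk s) 0 0 ∈ QRu B at this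
    rw [hR] at this
    exact neg_mem_iff.1 this
  exact inv_mem_inverseClosedAlg hmem

theorem freeDerivation_univU (hu : univU B ∈ QRu B) :
    freeDerivation B ⟨univU B, hu⟩ = 1 ⊗ₜ[ℂ] 1 :=
  freeDerivation_eq IsFreeDerivative.univU

theorem freeDerivation_bToQ (b : B) : freeDerivation B (bToQ B b) = 0 :=
  freeDerivation_eq (IsFreeDerivative.of_mem_range b)

end FreeDerivation

/-! ### Restriction to `LR(u; B)` and rescaling of the graph. -/

section Deformation

/-- The restriction of the derivation to `LR(u; B)`. -/
theorem exists_derivation_LRu (B : Type u) [CStarAlgebra B] :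
    ∃ dL : LRu B →ₗ[ℂ] LRu B ⊗[ℂ] LRu B,
      IsTensorDerivation dL ∧
      (∀ (n : ℕ) (σ : Gr (Matrix (Fin n) (Fin n) B))
        (hσ : σ ∈ grResolventSet (inclB B) (Fin n) (univUGr B)) (i j : Fin n),
        dL (coeff _ hσ i j) = ∑ k, coeff _ hσ i k ⊗ₜ[ℂ] coeff _ hσ k j) ∧
      ∀ x : LRu B, TensorProduct.map (resolventAlgToQ _ _) (resolventAlgToQ _ _) (dL x) =
        freeDerivation B (resolventAlgToQ _ _ x) := by
  have hd : ∀ x y : LRu B, (freeDerivation B ∘ₗ resolventAlgToQ _ _) (x * y) =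
      (LinearMap.mulLeft ℂ (resolventAlgToQ _ _ x)).rTensor (QRu B)
        ((freeDerivation B ∘ₗ resolventAlgToQ _ _) y) +
      (LinearMap.mulRight ℂ (resolventAlgToQ _ _ y)).lTensor (QRu B)
        ((freeDerivation B ∘ₗ resolventAlgToQ _ _) x) := fun x y =>
    isTensorDerivation_freeDerivation (resolventAlgToQ _ _ x) (resolventAlgToQ _ _ y)
  have hm : ∀ x y : LRu B, resolventAlgToQ _ _ (x * y) =
    resolventAlgToQ _ _ x * resolventAlgToQ _ _ y := fun _ _ => rfl
  exact exists_resolventAlg_derivation (inclB B) (resolventAlgToQ _ _)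
    (resolventAlgToQ_injective _ _) hm _ hd fun n σ hσ i j => freeDerivation_coeff hσ i j

attribute [local instance] Matrix.linftyOpNormedRing in
/-- Resolvents depend differentiably on a rescaling of the graph. -/
theorem hasDerivAt_grResolvent_graph_exp_smul {B E : Type*} [Ring B] [NormedRing E]
    [NormedAlgebra ℂ E] [CompleteSpace E] (ι : B →+* E) (Y : E) {n : Type*} [Fintype n]
    [DecidableEq n] {σ : Gr (Matrix n n B)} (hσ : σ ∈ grResolventSet ι n (Gr.graph Y)) :
    (∀ᶠ t : ℂ in 𝓝 0, σ ∈ grResolventSet ι n (Gr.graph (Complex.exp t • Y))) ∧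
      ∀ i j, HasDerivAt (fun t : ℂ => grResolvent ι (Gr.graph (Complex.exp t • Y)) σ i j)
        (∑ k, grResolvent ι (Gr.graph Y) σ i k * Y * grResolvent ι (Gr.graph Y) σ k j) 0 := by
  obtain ⟨s, rfl⟩ : ∃ s, σ = Gr.mk s := ⟨σ.out, (Quotient.out_eq σ).symm⟩
  have e0 : Complex.exp 0 • Y = Y := by simp
  have hc : Continuous fun t : ℂ => graphPencil ι (Complex.exp t • Y) s := by
    unfold graphPencil
    refine continuous_const.sub (Continuous.mul ?_ continuous_const)
    exact Continuous.matrix_diagonal (continuous_pi fun _ =>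
      (Complex.continuous_exp.smul continuous_const : Continuous fun t => Complex.exp t • Y))
  -- Completeness for the matrix norm makes the invertible matrices open and inversion continuous.
  have hcompl : @CompleteSpace (Matrix n n E) PseudoMetricSpace.toUniformSpace :=
    inferInstanceAs (CompleteSpace (n → n → E))
  have hu : IsUnit (graphPencil ι (Complex.exp 0 • Y) s) := by
    rw [e0]; exact (mem_grResolventSet_graph ι Y s).1 hσ
  have hev : ∀ᶠ t : ℂ in 𝓝 0, Gr.mk s ∈ grResolventSet ι n (Gr.graph (Complex.exp t • Y)) := by
    simp only [mem_grResolventSet_graph]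
    exact hc.continuousAt.eventually (Units.isOpen.eventually_mem hu)
  refine ⟨hev, fun i j => ?_⟩
  have hinv : ContinuousAt (fun t : ℂ => Ring.inverse (graphPencil ι (Complex.exp t • Y) s)) 0 := by
    obtain ⟨z, hz⟩ := hu
    have := NormedRing.inverse_continuousAt z
    rw [hz] at this
    exact ContinuousAt.comp (f := fun t : ℂ => graphPencil ι (Complex.exp t • Y) s) this
      hc.continuousAt
  have hR : ∀ i k, ContinuousAt
      (fun t : ℂ => grResolvent ι (Gr.graph (Complex.exp t • Y)) (Gr.mk s) i k) 0 := by
    intro i k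
    have h1 : ContinuousAt
        (fun t : ℂ => grResolvent ι (Gr.graph (Complex.exp t • Y)) (Gr.mk s)) 0 := by
      simp only [grResolvent_graph]
      exact continuousAt_const.mul hinv
    exact ((continuous_id.matrix_elem i k).continuousAt.comp h1 :)
  have hF : Filter.Tendsto (fun t : ℂ => ∑ k,
      grResolvent ι (Gr.graph (Complex.exp t • Y)) (Gr.mk s) i k * Y *
      grResolvent ι (Gr.graph Y) (Gr.mk s) k j) (𝓝[≠] 0)
      (𝓝 (∑ k, grResolvent ι (Gr.graph Y) (Gr.mk s) i k * Y *
        grResolvent ι (Gr.graph Y) (Gr.mk s) k j)) := by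
    refine tendsto_finsetSum _ fun k _ => Filter.Tendsto.mul_const _ (Filter.Tendsto.mul_const _ ?_)
    have := (hR i k).tendsto
    rw [e0] at this
    exact this.mono_left nhdsWithin_le_nhds
  have hexp : Filter.Tendsto (fun t : ℂ => t⁻¹ * (Complex.exp t - 1)) (𝓝[≠] 0) (𝓝 1) := by
    simpa using (Complex.hasDerivAt_exp 0).tendsto_slope_zero
  rw [hasDerivAt_iff_tendsto_slope]
  have := hexp.smul hF
  rw [one_smul] at this
  -- For small `t ≠ 0` the resolvent identity writes the difference quotient as `(e^t - 1)/t` times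
  -- `R(e^t Y) Y R(Y)`.
  refine this.congr' ?_
  filter_upwards [hev.filter_mono nhdsWithin_le_nhds] with t ht
  have h := congrFun (congrFun (grResolvent_graph_sub ι hσ ht) i) j
  have e : Complex.exp t • Y - Y = (Complex.exp t - 1) • Y := by rw [sub_smul, one_smul]
  rw [slope_def_module, e0, sub_zero, ← Matrix.sub_apply, h, e, mul_smul]
  congr 1
  simp [Matrix.mul_apply, Matrix.diagonal_apply, Finset.smul_sum]

end Deformation

/-! ### Cayley transforms of graphs. -/

section Cayley

variable {B E : Type*} [Ring B] [Algebra ℂ B] [Ring E] [Algebra ℂ E] (ι : B →+* E)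
  {n : Type*} [Fintype n] [DecidableEq n]

/-- A scalar matrix as an element of `GL(2; R)`. -/
def scalarGL2 (R : Type*) [Ring R] [Algebra ℂ R] : GL2 ℂ →* GL2 R :=
  Units.map (algebraMap ℂ R).mapMatrix.toMonoidHom

/-- Scalars are compatible with `ι` and with amplification, so a complex matrix acting on both
arguments factors out on the left. Transversality is therefore unchanged. -/
theorem pairMatrix_scalarGL2_mul (hι : ∀ c, ι (algebraMap ℂ B c) = algebraMap ℂ E c) (c : GL2 ℂ)
    (p : GL2 E) (s : GL2 (Matrix n n B)) :
    pairMatrix ι (scalarGL2 E c * p) (scalarGL2 _ c * s) =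
      (scalarGL2 (Matrix n n E) c).1 * pairMatrix ι p s := by
  have e : ∀ (z : ℂ) (M : Matrix n n B),
      (algebraMap ℂ (Matrix n n B) z * M).map ι = algebraMap ℂ (Matrix n n E) z * M.map ι := by
    intro z M
    rw [Matrix.map_mul]
    congr 1
    ext i j
    by_cases h : i = j <;> simp [h, Matrix.algebraMap_matrix_apply, hι]
  have e' : ∀ (z : ℂ), Matrix.scalar n (algebraMap ℂ E z) = algebraMap ℂ (Matrix n n E) z :=
    fun z => rfl
  ext a b : 2
  fin_cases a <;> fin_cases b <;>
    simp [pairMatrix, scalarGL2, Matrix.mul_apply (n := _) (m := Fin 2), Fin.sum_univ_two, e, e',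
      Matrix.map_add, -Matrix.scalar_apply]

/-- The resolvents of the Cayley transform of a graph. -/
theorem exists_grResolvent_cayley (hι : ∀ c, ι (algebraMap ℂ B c) = algebraMap ℂ E c) {Y : E}
    {ν : Gr (Matrix n n B)}
    (hν : ν ∈ grResolventSet ι n (Gr.act (scalarGL2 E cayley) (Gr.graph Y))) :
    ∃ σ ∈ grResolventSet ι n (Gr.graph Y),
      grResolvent ι (Gr.act (scalarGL2 E cayley) (Gr.graph Y)) ν =
        (Complex.I / 2) • (Matrix.scalar n (1 - Y) -
          Matrix.scalar n (1 - Y) * grResolvent ι (Gr.graph Y) σ * Matrix.scalar n (1 - Y)) := by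
  induction ν using Quotient.inductionOn with | _ s => ?_
  obtain ⟨s', rfl⟩ : ∃ s', s = scalarGL2 (Matrix n n B) cayley * s' :=
    ⟨(scalarGL2 _ cayley)⁻¹ * s, by rw [mul_inv_cancel_left]⟩
  let p : GL2 E := ⟨!![0, 1; 1, Y], !![-Y, 1; 1, 0], by simp [Matrix.one_fin_two],
    by simp [Matrix.one_fin_two]⟩
  have hP := pairMatrix_scalarGL2_mul ι hι cayley p s'
  have hν' : IsUnit (pairMatrix ι (scalarGL2 E cayley * p) (scalarGL2 _ cayley * s')) := hν
  rw [hP, Units.isUnit_units_mul] at hν'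
  refine ⟨Gr.mk s', hν', ?_⟩
  obtain ⟨P, hP'⟩ := hν'
  have hR : grResolvent ι (Gr.graph Y) (Gr.mk s') = (s'.1 0 1).map ι * P⁻¹.1 1 1 := by
    change _ * Ring.inverse (pairMatrix ι p s') 1 1 = _
    rw [← hP', Ring.inverse_unit]
  have hmap : ∀ (z : ℂ) (M : Matrix n n B), (z • M).map ι = z • M.map ι := by
    intro z M
    ext i j
    rw [Matrix.map_apply, Matrix.smul_apply, Matrix.smul_apply, Matrix.map_apply, Algebra.smul_def,
      Algebra.smul_def, map_mul, hι]
  have hβ : ((scalarGL2 (Matrix n n B) cayley * s').1 0 1).map ι =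
      Complex.I • ((s'.1 1 1).map ι - (s'.1 0 1).map ι) := by
    have : (scalarGL2 (Matrix n n B) cayley * s').1 0 1 = Complex.I • (s'.1 1 1 - s'.1 0 1) := by
      simp [scalarGL2, cayley, Matrix.mul_apply (m := Fin 2), Fin.sum_univ_two, Algebra.smul_def,
        mul_add, add_comm, sub_eq_add_neg]
    rw [this, hmap, Matrix.map_sub _ (map_sub ι)]
  have hζ : Ring.inverse ((scalarGL2 (Matrix n n E) cayley).1 * pairMatrix ι p s') 1 1 =
      (1 / 2 : ℂ) • (P⁻¹.1 1 0 + P⁻¹.1 1 1) := by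
    rw [← hP', ← Units.val_mul, Ring.inverse_unit, mul_inv_rev, Units.val_mul, Matrix.mul_apply,
      Fin.sum_univ_two, smul_add]
    have h0 : (scalarGL2 (Matrix n n E) cayley)⁻¹.1 0 1 = algebraMap ℂ _ (1 / 2) := rfl
    have h1 : (scalarGL2 (Matrix n n E) cayley)⁻¹.1 1 1 = algebraMap ℂ _ (1 / 2) := rfl
    rw [h0, h1, ← Algebra.commutes, ← Algebra.commutes, ← Algebra.smul_def, ← Algebra.smul_def]
  have e11 := congrFun (congrFun P.mul_inv 1) 1
  have e01 := congrFun (congrFun P.mul_inv 0) 1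
  have f10 := congrFun (congrFun P.inv_mul 1) 0
  simp only [Matrix.mul_apply (m := Fin 2), Fin.sum_univ_two, hP', pairMatrix, Matrix.of_apply,
    Matrix.cons_val_zero, Matrix.cons_val_one, Matrix.one_apply, p, map_one, mul_one, one_mul]
    at e11 e01 f10
  norm_num [-Matrix.scalar_apply] at e11 e01 f10
  -- With `ζ` the lower right entry of `P⁻¹` and `R = βζ`, the equations for `P` and `P⁻¹` give the
  -- lower left entry `-ζY` and `δζ = 1 + YR`. Hence the transformed resolvent `(i/2)(δ - β)ζ(1 -
  -- Y)` equals `(i/2)(1 - (1 - Y)R)(1 - Y)`.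
  have f : P⁻¹.1 1 0 = -(P⁻¹.1 1 1 * Matrix.scalar n Y) := eq_neg_of_add_eq_zero_left f10
  have e0 : P⁻¹.1 0 1 = -((s'.1 0 1).map ι * P⁻¹.1 1 1) := eq_neg_of_add_eq_zero_left e01
  have e1 : (s'.1 1 1).map ι * P⁻¹.1 1 1 =
      1 + Matrix.scalar n Y * ((s'.1 0 1).map ι * P⁻¹.1 1 1) := by
    rw [← e11, e0]; noncomm_ring
  refine Eq.trans (b := ((scalarGL2 (Matrix n n B) cayley * s').1 0 1).map ι *
    Ring.inverse (pairMatrix ι (scalarGL2 E cayley * p) (scalarGL2 _ cayley * s')) 1 1) rfl ?_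
  rw [hP, hβ, hζ, hR, f, smul_mul_smul_comm, ← mul_one_div Complex.I 2]
  congr 1
  have : ((s'.1 1 1).map ι - (s'.1 0 1).map ι) *
      (-(P⁻¹.1 1 1 * Matrix.scalar n Y) + P⁻¹.1 1 1) =
      ((s'.1 1 1).map ι * P⁻¹.1 1 1 - (s'.1 0 1).map ι * P⁻¹.1 1 1) * (1 - Matrix.scalar n Y) := by
    noncomm_ring
  rw [this, e1, map_sub, map_one]
  noncomm_ring

end Cayley

/-! ### The derivation twisted by the Cayley transform. -/

section CayleyDerivation

variable {A : Type*} [Ring A] [Algebra ℂ A]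

/-- The map `w ↦ -i/2 (1 ⊗ a) w (a ⊗ 1)`. -/
def cayleyTwist (a : A) : A ⊗[ℂ] A →ₗ[ℂ] A ⊗[ℂ] A :=
  (-(Complex.I / 2)) • (LinearMap.mulLeft ℂ (1 ⊗ₜ a) ∘ₗ LinearMap.mulRight ℂ (a ⊗ₜ 1))

theorem cayleyTwist_apply (a : A) (w : A ⊗[ℂ] A) :
    cayleyTwist a w = (-(Complex.I / 2)) • ((1 ⊗ₜ a) * w * (a ⊗ₜ 1)) := by
  simp [cayleyTwist, mul_assoc]

theorem cayleyTwist_tmul (a x y : A) :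
    cayleyTwist a (x ⊗ₜ y) = (-(Complex.I / 2)) • ((x * a) ⊗ₜ (a * y)) := by
  simp [cayleyTwist_apply]

/-- The twist acts on the inner sides of the two legs, while the bimodule structure acts on the
outer sides. The two commute, so the twist of a derivation is again a derivation. -/
theorem cayleyTwist_rTensor (a x : A) (w : A ⊗[ℂ] A) :
    cayleyTwist a ((LinearMap.mulLeft ℂ x).rTensor A w) =
      (LinearMap.mulLeft ℂ x).rTensor A (cayleyTwist a w) := by
  induction w with
  | zero => simp
  | add y z hy hz => simp only [map_add, hy, hz]
  | tmul y z => simp [cayleyTwist_tmul, mul_assoc]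

theorem cayleyTwist_lTensor (a x : A) (w : A ⊗[ℂ] A) :
    cayleyTwist a ((LinearMap.mulRight ℂ x).lTensor A w) =
      (LinearMap.mulRight ℂ x).lTensor A (cayleyTwist a w) := by
  induction w with
  | zero => simp
  | add y z hy hz => simp only [map_add, hy, hz]
  | tmul y z => simp [cayleyTwist_tmul, mul_assoc]

/-- The twisted derivation satisfies the resolvent equation at the Cayley transform of a solution
of the resolvent equation. -/
theorem cayleyTwist_resolvent {n : Type*} [Fintype n] [DecidableEq n] {d : A →ₗ[ℂ] A ⊗[ℂ] A}
    (hd : IsTensorDerivation d) {a : A} (ha : d a = -(1 ⊗ₜ 1)) {x : n → n → A}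
    (hx : ∀ i j, d (x i j) = ∑ k, x i k ⊗ₜ x k j) {z : n → n → A}
    (hz : ∀ i j, z i j = (Complex.I / 2) • ((if i = j then a else 0) - a * x i j * a)) (i j : n) :
    cayleyTwist a (d (z i j)) = ∑ k, z i k ⊗ₜ z k j := by
  have h1 : d (a * x i j * a) = ∑ k, (a * x i k) ⊗ₜ (x k j * a) - 1 ⊗ₜ (x i j * a) -
      (a * x i j) ⊗ₜ 1 := by
    rw [hd, hd, ha, hx]
    simp [map_sum]
    abel
  have h2 : d (if i = j then a else 0) = if i = j then -(1 ⊗ₜ 1) else 0 := by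
    split_ifs <;> simp [ha]
  -- The diagonal term `a` supplies `a ⊗ a`; together with the three terms of `h1` it matches the
  -- expansion of `∑ k, z i k ⊗ z k j`.
  have h3 : cayleyTwist a (if i = j then -(1 ⊗ₜ 1) else 0) =
      if i = j then (Complex.I / 2) • (a ⊗ₜ a) else 0 := by
    split_ifs <;> simp [cayleyTwist_tmul]
  simp only [hz, TensorProduct.smul_tmul_smul, ← Finset.smul_sum]
  rw [map_smul, map_smul, map_sub, map_sub, h1, h2, h3, map_sub, map_sub, map_sum, mul_smul]
  congr 1
  simp only [cayleyTwist_tmul, TensorProduct.sub_tmul, TensorProduct.tmul_sub,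
    Finset.sum_sub_distrib, TensorProduct.ite_tmul, TensorProduct.tmul_ite]
  simp [mul_assoc, smul_sub, Finset.smul_sum]
  by_cases h : i = j <;> simp [h] <;> abel

end CayleyDerivation

/-! ### The derivation on `LR(χ; B)`. -/

section Chi

variable (B : Type u) [CStarAlgebra B]

theorem inclB_algebraMap (c : ℂ) : inclB B (algebraMap ℂ B c) = algebraMap ℂ (EAlg B) c :=
  AlgHomClass.commutes (FreeProd.inl B C(Circle, ℂ)) c

variable {B}

/-- The resolvents of `χ` in terms of the resolvents of `u`. -/
theorem exists_coeff_univChi {n : ℕ} {ν : Gr (Matrix (Fin n) (Fin n) B)}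
    (hν : ν ∈ grResolventSet (inclB B) (Fin n) (univChi B)) :
    ∃ (σ : Gr (Matrix (Fin n) (Fin n) B))
      (hσ : σ ∈ grResolventSet (inclB B) (Fin n) (univUGr B)), ∀ i j,
      grResolvent (inclB B) (univChi B) ν i j = (Complex.I / 2) •
        ((if i = j then 1 - univU B else 0) -
          (1 - univU B) * (coeff _ hσ i j : EAlg B) * (1 - univU B)) := by
  obtain ⟨σ, hσ, h⟩ := exists_grResolvent_cayley (inclB B) (inclB_algebraMap B) hν
  refine ⟨σ, hσ, fun i j => ?_⟩
  refine (congrFun (congrFun h i) j).trans ?_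
  rw [Matrix.smul_apply, Matrix.sub_apply, Matrix.scalar_apply, Matrix.mul_diagonal,
    Matrix.diagonal_mul, Matrix.diagonal_apply]
  rfl

theorem mem_resolventQAlg_of_mem_LRchi {x : EAlg B} (hx : x ∈ LRchi B) : x ∈ QRu B := by
  have h : (Subalgebra.toSubmodule (QRu B)).comap
      (NonUnitalSubalgebra.toSubmodule (LRchi B)).subtype = ⊤ := by
    refine submodule_eq_top_of_coeff_mem _ _ fun n ν hν i j => ?_
    obtain ⟨σ, hσ, h⟩ := exists_coeff_univChi hν
    change grResolvent (inclB B) (univChi B) ν i j ∈ QRu B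
    rw [h]
    have ha : 1 - univU B ∈ QRu B := sub_mem (one_mem _) (univU_mem_resolventQAlg B)
    refine (QRu B).smul_mem (sub_mem ?_ (mul_mem (mul_mem ha ?_) ha)) _
    · split_ifs
      exacts [ha, zero_mem _]
    · exact (resolventAlgToQ _ _ (coeff _ hσ i j)).2
  exact (Submodule.eq_top_iff'.1 h ⟨x, hx⟩ : _)

theorem exists_derivation_LRchi (hu : univU B ∈ QRu B) (hχ : ∀ x ∈ LRchi B, x ∈ QRu B) :
    ∃ dχ : LRchi B →ₗ[ℂ] LRchi B ⊗[ℂ] LRchi B,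
      IsTensorDerivation dχ ∧
      (∀ (n : ℕ) (ν : Gr (Matrix (Fin n) (Fin n) B))
        (hν : ν ∈ grResolventSet (inclB B) (Fin n) (univChi B)) (i j : Fin n),
        dχ (coeff _ hν i j) = ∑ k, coeff _ hν i k ⊗ₜ[ℂ] coeff _ hν k j) ∧
      ∀ ξ : LRchi B, TensorProduct.map (chiToQ B hχ) (chiToQ B hχ) (dχ ξ) =
        (-(Complex.I / 2)) • ((1 ⊗ₜ[ℂ] (1 - ⟨univU B, hu⟩)) * freeDerivation B (chiToQ B hχ ξ) *
          ((1 - ⟨univU B, hu⟩) ⊗ₜ[ℂ] 1)) := by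
  let a : QRu B := 1 - ⟨univU B, hu⟩
  let d : LRchi B →ₗ[ℂ] QRu B ⊗[ℂ] QRu B :=
    cayleyTwist a ∘ₗ freeDerivation B ∘ₗ chiToQ B hχ
  -- `∂1 = 0` because `1` lies in `B`; hence `∂(1 - u) = -(1 ⊗ 1)`, the value that
  -- `cayleyTwist_resolvent` requires.
  have ha : freeDerivation B a = -(1 ⊗ₜ 1) := by
    have h1 : freeDerivation B 1 = 0 := by
      have := freeDerivation_bToQ (1 : B)
      rwa [show bToQ B (1 : B) = 1 from Subtype.ext (map_one (inclB B))] at this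
    rw [map_sub, h1, freeDerivation_univU, zero_sub]
  have hinj : Function.Injective (chiToQ B hχ) :=
    fun _ _ h => Subtype.ext (congrArg (fun z : QRu B => (z : EAlg B)) h)
  have hm : ∀ x y : LRchi B, chiToQ B hχ (x * y) = chiToQ B hχ x * chiToQ B hχ y := fun _ _ => rfl
  have hd : ∀ x y : LRchi B, d (x * y) =
      (LinearMap.mulLeft ℂ (chiToQ B hχ x)).rTensor (QRu B) (d y) +
      (LinearMap.mulRight ℂ (chiToQ B hχ y)).lTensor (QRu B) (d x) := by
    intro x y
    change cayleyTwist a (freeDerivation B (chiToQ B hχ x * chiToQ B hχ y)) = _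
    rw [isTensorDerivation_freeDerivation, map_add, cayleyTwist_rTensor, cayleyTwist_lTensor]
    rfl
  have hc : ∀ (n : ℕ) (ν : Gr (Matrix (Fin n) (Fin n) B))
      (hν : ν ∈ grResolventSet (inclB B) (Fin n) (univChi B)) (i l : Fin n),
      d (coeff _ hν i l) =
        ∑ k, chiToQ B hχ (coeff _ hν i k) ⊗ₜ[ℂ] chiToQ B hχ (coeff _ hν k l) := by
    intro n ν hν i l
    obtain ⟨σ, hσ, h⟩ := exists_coeff_univChi hν
    refine cayleyTwist_resolvent isTensorDerivation_freeDerivation ha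
      (x := fun i j => resolventAlgToQ _ _ (coeff _ hσ i j)) (freeDerivation_coeff hσ)
      (z := fun i j => chiToQ B hχ (coeff _ hν i j)) (fun i j => Subtype.ext ?_) i l
    refine (h i j).trans ?_
    split_ifs <;> rfl
  obtain ⟨d', h1, h2, h3⟩ := exists_resolventAlg_derivation (inclB B) (chiToQ B hχ) hinj hm d hd hc
  exact ⟨d', h1, h2, fun ξ => (h3 ξ).trans (cayleyTwist_apply a _)⟩

end Chi

end VoicFree

end

theorem proposition12p2 (B : Type*) [CStarAlgebra B] :
    ∃ dQ : QRu B →ₗ[ℂ] QRu B ⊗[ℂ] QRu B,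
      -- the derivation on `QR(u; B)`
      IsTensorDerivation dQ ∧
      (∀ (n : ℕ) (σ : Gr (Matrix (Fin n) (Fin n) B))
        (hσ : σ ∈ grResolventSet (inclB B) (Fin n) (univUGr B)) (i j : Fin n),
        dQ (resolventAlgToQ _ _ (coeff _ hσ i j)) =
          ∑ k, resolventAlgToQ _ _ (coeff _ hσ i k) ⊗ₜ[ℂ] resolventAlgToQ _ _ (coeff _ hσ k j)) ∧
      (∀ b : B, dQ (bToQ B b) = 0) ∧
      (∃ hu : univU B ∈ QRu B, dQ ⟨univU B, hu⟩ = 1 ⊗ₜ[ℂ] 1) ∧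
      -- its restriction to `LR(u; B)`
      (∃ dL : LRu B →ₗ[ℂ] LRu B ⊗[ℂ] LRu B,
        IsTensorDerivation dL ∧
        (∀ (n : ℕ) (σ : Gr (Matrix (Fin n) (Fin n) B))
          (hσ : σ ∈ grResolventSet (inclB B) (Fin n) (univUGr B)) (i j : Fin n),
          dL (coeff _ hσ i j) = ∑ k, coeff _ hσ i k ⊗ₜ[ℂ] coeff _ hσ k j) ∧
        ∀ x : LRu B, TensorProduct.map (resolventAlgToQ _ _) (resolventAlgToQ _ _) (dL x) =
          dQ (resolventAlgToQ _ _ x)) ∧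
      -- the deformation map `D` for `u`
      (∃ D : LRu B →ₗ[ℂ] EAlg B,
        ∀ (n : ℕ) (σ : Gr (Matrix (Fin n) (Fin n) B))
          (hσ : σ ∈ grResolventSet (inclB B) (Fin n) (univUGr B)),
          (∀ᶠ t : ℂ in 𝓝 0,
            σ ∈ grResolventSet (inclB B) (Fin n) (Gr.graph (Complex.exp t • univU B))) ∧
          ∀ i j : Fin n, HasDerivAt
            (fun t : ℂ => grResolvent (inclB B) (Gr.graph (Complex.exp t • univU B)) σ i j)
            (D (coeff _ hσ i j)) 0) ∧
      -- the derivation on `LR(χ; B)`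
      (∃ (hu : univU B ∈ QRu B) (hχ : ∀ x ∈ LRchi B, x ∈ QRu B)
        (dχ : LRchi B →ₗ[ℂ] LRchi B ⊗[ℂ] LRchi B),
        IsTensorDerivation dχ ∧
        (∀ (n : ℕ) (ν : Gr (Matrix (Fin n) (Fin n) B))
          (hν : ν ∈ grResolventSet (inclB B) (Fin n) (univChi B)) (i j : Fin n),
          dχ (coeff _ hν i j) = ∑ k, coeff _ hν i k ⊗ₜ[ℂ] coeff _ hν k j) ∧
        ∀ ξ : LRchi B, TensorProduct.map (chiToQ B hχ) (chiToQ B hχ) (dχ ξ) =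
          (-(Complex.I / 2)) • ((1 ⊗ₜ[ℂ] (1 - ⟨univU B, hu⟩)) * dQ (chiToQ B hχ ξ) *
            ((1 - ⟨univU B, hu⟩) ⊗ₜ[ℂ] 1))) := by
  refine ⟨freeDerivation B, isTensorDerivation_freeDerivation,
    fun n σ hσ i j => freeDerivation_coeff hσ i j, freeDerivation_bToQ,
    ⟨univU_mem_resolventQAlg B, freeDerivation_univU _⟩, exists_derivation_LRu B,
    -- Inserting `u` between the two legs sends `∑ k, R i k ⊗ R k j` to `∑ k, R i k * u * R k j`.
    -- Being built from `∂`, this is automatically well defined and linear on `LR(u; B)`.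
    ⟨sandwich (QRu B).val (univU B) ∘ₗ freeDerivation B ∘ₗ resolventAlgToQ _ _,
      fun n σ hσ => ?_⟩,
    ⟨univU_mem_resolventQAlg B, fun x hx => mem_resolventQAlg_of_mem_LRchi hx,
      exists_derivation_LRchi _ _⟩⟩
  obtain ⟨h1, h2⟩ := hasDerivAt_grResolvent_graph_exp_smul (inclB B) (univU B) hσ
  refine ⟨h1, fun i j => ?_⟩
  convert h2 i j using 1
  rw [LinearMap.comp_apply, LinearMap.comp_apply, freeDerivation_coeff, map_sum]
  simp only [sandwich_tmul]
  rfl
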